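/- **Setting.** Let $H_i=(D_i,Z_i,X_i,Y_i)$, $i\ge 1$, be i.i.d., where the treatment $D_i$ and the moderator $Z_i$ take values in finite sets $\mathcal D,\mathcal Z$, the covariates $X_i$ take values in a measurable space $\mathcal X$, and the outcome $Y_i$ is real and integrable. Let $$\mu_d(z,x)=\mathrm E[Y_i\mid D_i=d,Z_i=z,X_i=x],\quad \pi_d(z,x)=P(D_i=d\mid Z_i=z,X_i=x),\quad \lambda_z(x)=P(Z_i=z\mid X_i=x)$$ (fixed measurable versions, written $\eta=(\mu,\pi,\lambda)$) and, with $\omega_{d,z}(x)=\pi_d(z,x)\lambda_z(x)$, $$\Gamma_{d,z}(h)=\mu_d(z,x)+\frac{\mathbf 1\{D=d,Z=z\}\,(y-\mu_d(z,x))}{\omega_{d,z}(x)} .$$ For treatments $l,m$ and moderator groups $u,v$ let $$\theta^{\Delta C}=\mathrm E[\Gamma_{l,u}(H_i)-\Gamma_{m,u}(H_i)-\Gamma_{l,v}(H_i)+\Gamma_{m,v}(H_i)],$$ $$\phi^{\Delta C}(h;\theta^{\Delta C},\eta)=\Gamma_{l,u}(h)-\Gamma_{m,u}(h)-\Gamma_{l,v}(h)+\Gamma_{m,v}(h)-\theta^{\Delta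 C}.$$ **Estimator.** Fix $K>1$. For each $N$ split $\{1,\dots,N\}$ into $K$ (possibly random) folds $S_1,\dots,S_K$ of equal size, up to one observation when $K\nmid N$. For each fold $k$ the estimates $\hat\mu_d,\hat\pi_d,\hat\lambda_z$ are computed by an arbitrary, possibly randomized, measurable procedure from the observations outside $S_k$ only; the folds and the seed of the procedure are jointly independent of the data. Let $\hat\Gamma_{d,z}$ be $\Gamma_{d,z}$ with $\mu_d$ replaced by $\hat\mu_d$ and $\omega_{d,z}(x)$ by the product $\hat\pi_d(z,x)\,\hat\lambda_z(x)$, and let $$\hat\theta^{\Delta C}=\frac1N\sum_{k=1}^K\sum_{i\in S_k}\bigl[\hat\Gamma_{l,u}(H_i)-\hat\Gamma_{m,u}(H_i)-\hat\Gamma_{l,v}(H_i)+\hat\Gamma_{m,v}(H_i)\bigr].$$ **Assumptions** (on the estimates of every fold, for all $d\in\mathcal D$, $z\in\mathcal Z$): 1. *Overlap:* for some $\kappa>0$, almost surely $\kappa<\lambda_z(x),\pi_d(z,x),\hat\lambda_z(x),\hat\pi_d(z,x)<1-\kappa$ for all $d,z,x$ and $N$. 2. *Consistency:* as $N\to\infty$,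 $\sup_{x,z}|\hat\mu_d(z,x)-\mu_d(z,x)|\to0$, $\sup_{x,z}|\hat\pi_d(z,x)-\pi_d(z,x)|\to0$ and $\sup_{x}|\hat\lambda_z(x)-\lambda_z(x)|\to0$ in probability. 3. *Risk decay:* with expectations over an independent copy $(Z,X)$ of $(Z_i,X_i)$, the estimates being held fixed, $\mathrm E[(\hat\mu_d(Z,X)-\mu_d(Z,X))^2]\,\mathrm E[(\hat\pi_d(Z,X)-\pi_d(Z,X))^2]=o_p(1/N)$ and $\mathrm E[(\hat\mu_d(Z,X)-\mu_d(Z,X))^2]\,\mathrm E[(\hat\lambda_z(X)-\lambda_z(X))^2]=o_p(1/N)$. 4. *Bounded conditional variance:* $\mathrm{Var}(Y_i\mid D_i=d,Z_i=z,X_i=x)\le\epsilon_d<\infty$ for all $z$ and (almost) all $x$. Moreover $V^\star:=\mathrm E[\phi^{\Delta C}(H_i;\theta^{\Delta C},\eta)^2]<\infty$. **Theorem.** Under these assumptions $\hat\theta^{\Delta C}$ is $\sqrt N$-consistent and asymptotically normal: $$\sqrt N\,(\hat\theta^{\Delta C}-\theta^{\Delta C})\xrightarrow{d}N(0,V^\star)\qquad(N\to\infty).$$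 Here $\theta^{\Delta C}$ is the causal $\Delta$CBGATE: whenever $(Y_i^{d,z})_{d,z}$ are integrable potential outcomes with $Y_i=Y_i^{D_i,Z_i}$ almost surely, $(Y_i^{d,Z_i})_d\perp D_i\mid(Z_i,X_i)$ and $(Y_i^{d,z})_{d,z}\perp Z_i\mid X_i$, then $$\theta^{\Delta C}=\mathrm E\bigl[(Y_i^{l,u}-Y_i^{m,u})-(Y_i^{l,v}-Y_i^{m,v})\bigr].$$ -/

import Mathlib

open MeasureTheory ProbabilityTheory Filter
open scoped ENNReal NNReal Topology

noncomputable section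

namespace CBGATE

/-- An observation `(D, Z, X, Y)`: treatment, moderator, covariates, outcome. -/
abbrev Obs (𝒟 𝒵 𝒳 : Type*) := 𝒟 × 𝒵 × 𝒳 × ℝ

/-- The treatment of an observation. -/
abbrev treat {𝒟 𝒵 𝒳 : Type*} (h : Obs 𝒟 𝒵 𝒳) : 𝒟 := h.1

/-- The moderator of an observation. -/
abbrev moder {𝒟 𝒵 𝒳 : Type*} (h : Obs 𝒟 𝒵 𝒳) : 𝒵 := h.2.1

/-- The covariates of an observation. -/
abbrev covar {𝒟 𝒵 𝒳 : Type*} (h : Obs 𝒟 𝒵 𝒳) : 𝒳 := h.2.2.1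

/-- The outcome of an observation. -/
abbrev outcome {𝒟 𝒵 𝒳 : Type*} (h : Obs 𝒟 𝒵 𝒳) : ℝ := h.2.2.2

/-- A triple of nuisance functions: `reg d z x` for the outcome regression `μ_d(z,x)`,
`ps d z x` for the treatment propensity `π_d(z,x)`, `mps z x` for the moderator propensity
`λ_z(x)`. -/
structure Nuisance (𝒟 𝒵 𝒳 : Type*) where
  reg : 𝒟 → 𝒵 → 𝒳 → ℝ
  ps : 𝒟 → 𝒵 → 𝒳 → ℝ
  mps : 𝒵 → 𝒳 → ℝ

/-- The doubly robust building block
`Γ_{d,z}(h) = μ_d(z,x) + 1{D = d, Z = z} (y - μ_d(z,x)) / (π_d(z,x) λ_z(x))`. -/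
def gamma {𝒟 𝒵 𝒳 : Type*} [DecidableEq 𝒟] [DecidableEq 𝒵] (η : Nuisance 𝒟 𝒵 𝒳)
    (d : 𝒟) (z : 𝒵) (h : Obs 𝒟 𝒵 𝒳) : ℝ :=
  η.reg d z (covar h) +
    (if treat h = d ∧ moder h = z then 1 else 0) * (outcome h - η.reg d z (covar h)) /
      (η.ps d z (covar h) * η.mps z (covar h))

/-- The contrast `Γ_{l,u}(h) - Γ_{m,u}(h) - Γ_{l,v}(h) + Γ_{m,v}(h)`. -/
def contrast {𝒟 𝒵 𝒳 : Type*} [DecidableEq 𝒟] [DecidableEq 𝒵] (η : Nuisance 𝒟 𝒵 𝒳)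
    (l m : 𝒟) (u v : 𝒵) (h : Obs 𝒟 𝒵 𝒳) : ℝ :=
  gamma η l u h - gamma η m u h - gamma η l v h + gamma η m v h

/-- The score `φ^{ΔC}(h; θ, η)`. -/
def score {𝒟 𝒵 𝒳 : Type*} [DecidableEq 𝒟] [DecidableEq 𝒵]
    (l m : 𝒟) (u v : 𝒵) (θ : ℝ) (η : Nuisance 𝒟 𝒵 𝒳) (h : Obs 𝒟 𝒵 𝒳) : ℝ :=
  contrast η l m u v h - θ

/-- The estimand `θ^{ΔC}_{l,m,u,v} = E[Γ_{l,u}(H) - Γ_{m,u}(H) - Γ_{l,v}(H) + Γ_{m,v}(H)]`, where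
`ν` is the law of an observation. -/
def estimand {𝒟 𝒵 𝒳 : Type*} [DecidableEq 𝒟] [DecidableEq 𝒵]
    [MeasurableSpace 𝒟] [MeasurableSpace 𝒵] [MeasurableSpace 𝒳]
    (ν : Measure (Obs 𝒟 𝒵 𝒳)) (η : Nuisance 𝒟 𝒵 𝒳) (l m : 𝒟) (u v : 𝒵) : ℝ :=
  ∫ h, contrast η l m u v h ∂ν

/-- The σ-algebra generated by `X`. -/
abbrev sigmaX (𝒟 𝒵 𝒳 : Type*) [MeasurableSpace 𝒳] : MeasurableSpace (Obs 𝒟 𝒵 𝒳) :=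
  MeasurableSpace.comap (fun h => covar h) inferInstance

/-- The σ-algebra generated by `(Z, X)`. -/
abbrev sigmaZX (𝒟 𝒵 𝒳 : Type*) [MeasurableSpace 𝒵] [MeasurableSpace 𝒳] :
    MeasurableSpace (Obs 𝒟 𝒵 𝒳) :=
  MeasurableSpace.comap (fun h => (moder h, covar h)) inferInstance

/-- The σ-algebra generated by `(D, Z, X)`. -/
abbrev sigmaDZX (𝒟 𝒵 𝒳 : Type*) [MeasurableSpace 𝒟] [MeasurableSpace 𝒵] [MeasurableSpace 𝒳] :
    MeasurableSpace (Obs 𝒟 𝒵 𝒳) :=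
  MeasurableSpace.comap (fun h => (treat h, moder h, covar h)) inferInstance

/-- `η` consists of (measurable versions of) the true nuisance functions under the law `ν`:
`μ_d(z,x) = E[Y | D = d, Z = z, X = x]`, `π_d(z,x) = P(D = d | Z = z, X = x)` and
`λ_z(x) = P(Z = z | X = x)`. -/
structure IsTrueNuisance {𝒟 𝒵 𝒳 : Type*}
    [MeasurableSpace 𝒟] [MeasurableSpace 𝒵] [MeasurableSpace 𝒳]
    (ν : Measure (Obs 𝒟 𝒵 𝒳)) (η : Nuisance 𝒟 𝒵 𝒳) : Prop where
  measurable_reg : ∀ d z, Measurable (η.reg d z)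
  measurable_ps : ∀ d z, Measurable (η.ps d z)
  measurable_mps : ∀ z, Measurable (η.mps z)
  reg_eq : (fun h => η.reg (treat h) (moder h) (covar h)) =ᵐ[ν] ν[outcome | sigmaDZX 𝒟 𝒵 𝒳]
  ps_eq : ∀ d, (fun h => η.ps d (moder h) (covar h)) =ᵐ[ν] ν⟦{h | treat h = d} | sigmaZX 𝒟 𝒵 𝒳⟧
  mps_eq : ∀ z, (fun h => η.mps z (covar h)) =ᵐ[ν] ν⟦{h | moder h = z} | sigmaX 𝒟 𝒵 𝒳⟧

/-- All propensities in `η` lie strictly between `κ` and `1 - κ`. -/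
def Overlap {𝒟 𝒵 𝒳 : Type*} (κ : ℝ) (η : Nuisance 𝒟 𝒵 𝒳) : Prop :=
  (∀ d z x, κ < η.ps d z x ∧ η.ps d z x < 1 - κ) ∧ (∀ z x, κ < η.mps z x ∧ η.mps z x < 1 - κ)

/-- The conditional variance of `Y` given `(D, Z, X)` is bounded on `{D = d}` by a constant `ε d`.
The first conjunct says that this variance is that of a square integrable residual (the Mathlib
conditional variance has the value `0` otherwise). -/
def BoundedCondVar {𝒟 𝒵 𝒳 : Type*}
    [MeasurableSpace 𝒟] [MeasurableSpace 𝒵] [MeasurableSpace 𝒳]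
    (ν : Measure (Obs 𝒟 𝒵 𝒳)) : Prop :=
  MemLp (outcome - ν[outcome | sigmaDZX 𝒟 𝒵 𝒳]) 2 ν ∧
    ∃ ε : 𝒟 → ℝ, ∀ᵐ h ∂ν, Var[outcome; ν | sigmaDZX 𝒟 𝒵 𝒳] h ≤ ε (treat h)

/-- A (possibly randomized) procedure that fits the nuisance functions: for each sample size `N`,
each set `I` of indices of training observations, each value of the training observations and each
value of the seed in `𝒰`, it returns fitted nuisance functions. -/
structure Learner (𝒟 𝒵 𝒳 𝒰 : Type*)
    [MeasurableSpace 𝒟] [MeasurableSpace 𝒵] [MeasurableSpace 𝒳] [MeasurableSpace 𝒰] where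
  fit : (N : ℕ) → (I : Finset (Fin N)) → (I → Obs 𝒟 𝒵 𝒳) → 𝒰 → Nuisance 𝒟 𝒵 𝒳
  measurable_reg : ∀ (N : ℕ) (I : Finset (Fin N)) (d : 𝒟) (z : 𝒵),
    Measurable fun q : (I → Obs 𝒟 𝒵 𝒳) × 𝒰 × 𝒳 => (fit N I q.1 q.2.1).reg d z q.2.2
  measurable_ps : ∀ (N : ℕ) (I : Finset (Fin N)) (d : 𝒟) (z : 𝒵),
    Measurable fun q : (I → Obs 𝒟 𝒵 𝒳) × 𝒰 × 𝒳 => (fit N I q.1 q.2.1).ps d z q.2.2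
  measurable_mps : ∀ (N : ℕ) (I : Finset (Fin N)) (z : 𝒵),
    Measurable fun q : (I → Obs 𝒟 𝒵 𝒳) × 𝒰 × 𝒳 => (fit N I q.1 q.2.1).mps z q.2.2

/-- The `k`-th fold of the fold assignment `s`. -/
def fold {N K : ℕ} (s : Fin N → Fin K) (k : Fin K) : Finset (Fin N) :=
  Finset.univ.filter fun i => s i = k

/-- The `K` folds have equal sizes, up to one observation when `K` does not divide `N`. -/
def Balanced {N K : ℕ} (s : Fin N → Fin K) : Prop :=
  ∀ k, N / K ≤ (fold s k).card ∧ (fold s k).card ≤ N / K + 1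

/-- The nuisance functions used on fold `k`: fitted on the observations outside fold `k`.
`H i` is the `i`-th observation, `U N` the seed and `S N` the fold assignment at sample size `N`. -/
def crossFit {Ω 𝒟 𝒵 𝒳 𝒰 : Type*}
    [MeasurableSpace 𝒟] [MeasurableSpace 𝒵] [MeasurableSpace 𝒳] [MeasurableSpace 𝒰] {K : ℕ}
    (L : Learner 𝒟 𝒵 𝒳 𝒰) (H : ℕ → Ω → Obs 𝒟 𝒵 𝒳) (U : ℕ → Ω → 𝒰)
    (S : (N : ℕ) → Ω → Fin N → Fin K) (N : ℕ) (k : Fin K) (ω : Ω) : Nuisance 𝒟 𝒵 𝒳 :=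
  L.fit N (fold (S N ω) k)ᶜ (fun i => H i.1 ω) (U N ω)

/-- The cross-fitted estimator `(1/N) ∑_k ∑_{i ∈ S_k} (Γ̂_{l,u} - Γ̂_{m,u} - Γ̂_{l,v} + Γ̂_{m,v})(H_i)`,
where on fold `k` the hats are fitted outside fold `k` and the propensity of `(d,z)` is estimated
by the product `π̂_d(z,x) λ̂_z(x)`. -/
def estimator {Ω 𝒟 𝒵 𝒳 𝒰 : Type*} [DecidableEq 𝒟] [DecidableEq 𝒵]
    [MeasurableSpace 𝒟] [MeasurableSpace 𝒵] [MeasurableSpace 𝒳] [MeasurableSpace 𝒰] {K : ℕ}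
    (L : Learner 𝒟 𝒵 𝒳 𝒰) (H : ℕ → Ω → Obs 𝒟 𝒵 𝒳) (U : ℕ → Ω → 𝒰)
    (S : (N : ℕ) → Ω → Fin N → Fin K) (l m : 𝒟) (u v : 𝒵) (N : ℕ) (ω : Ω) : ℝ :=
  (1 / (N : ℝ)) * ∑ k : Fin K, ∑ i ∈ fold (S N ω) k,
    contrast (crossFit L H U S N k ω) l m u v (H i ω)

/-- A sequence of `[0,∞]`-valued random quantities tends to `0` in probability (in outer probability
where a quantity is not measurable). -/
def TendstoZeroInProb {Ω : Type*} [MeasurableSpace Ω] (P : Measure Ω) (f : ℕ → Ω → ℝ≥0∞) : Prop :=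
  ∀ ε : ℝ≥0∞, 0 < ε → Tendsto (fun N => P {ω | ε ≤ f N ω}) atTop (𝓝 0)

/-- Sup-norm consistency of a sequence `est N ω` of random nuisance functions for `η`. The suprema
take values in `[0,∞]`. -/
structure Consistent {Ω 𝒟 𝒵 𝒳 : Type*} [MeasurableSpace Ω] (P : Measure Ω)
    (est : ℕ → Ω → Nuisance 𝒟 𝒵 𝒳) (η : Nuisance 𝒟 𝒵 𝒳) : Prop where
  reg : ∀ d, TendstoZeroInProb P
    (fun N ω => ⨆ (z : 𝒵) (x : 𝒳), ‖(est N ω).reg d z x - η.reg d z x‖ₑ)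
  ps : ∀ d, TendstoZeroInProb P
    (fun N ω => ⨆ (z : 𝒵) (x : 𝒳), ‖(est N ω).ps d z x - η.ps d z x‖ₑ)
  mps : ∀ z, TendstoZeroInProb P
    (fun N ω => ⨆ x : 𝒳, ‖(est N ω).mps z x - η.mps z x‖ₑ)

/-- Mean squared error, over a fresh observation `h ∼ ν`, of a fitted function `f` of `(z,x)`. -/
def mse {𝒟 𝒵 𝒳 : Type*} [MeasurableSpace 𝒟] [MeasurableSpace 𝒵] [MeasurableSpace 𝒳]
    (ν : Measure (Obs 𝒟 𝒵 𝒳)) (f g : 𝒵 → 𝒳 → ℝ) : ℝ≥0∞ :=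
  ∫⁻ h, ‖f (moder h) (covar h) - g (moder h) (covar h)‖ₑ ^ 2 ∂ν

/-- Risk decay: the products of the mean squared errors of the outcome regression and of each of the
two propensities are `o_p(1/N)`. -/
structure RiskDecay {Ω 𝒟 𝒵 𝒳 : Type*} [MeasurableSpace Ω]
    [MeasurableSpace 𝒟] [MeasurableSpace 𝒵] [MeasurableSpace 𝒳] (P : Measure Ω)
    (ν : Measure (Obs 𝒟 𝒵 𝒳)) (est : ℕ → Ω → Nuisance 𝒟 𝒵 𝒳) (η : Nuisance 𝒟 𝒵 𝒳) : Prop where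
  reg_ps : ∀ d, TendstoZeroInProb P
    (fun N ω => (N : ℝ≥0∞) *
      (mse ν ((est N ω).reg d) (η.reg d) * mse ν ((est N ω).ps d) (η.ps d)))
  reg_mps : ∀ d z, TendstoZeroInProb P
    (fun N ω => (N : ℝ≥0∞) *
      (mse ν ((est N ω).reg d) (η.reg d) *
        mse ν (fun _ => (est N ω).mps z) (fun _ => η.mps z)))

/-- `f` and `g` are conditionally independent given the σ-algebra `m'`. (This is the
characterization `condIndepFun_iff_condExp_inter_preimage_eq_mul` of `CondIndepFun`, which Mathlib
defines only on standard Borel spaces.) -/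
def CondIndepGiven {Ω β γ : Type*} [MeasurableSpace Ω] [MeasurableSpace β] [MeasurableSpace γ]
    (P : Measure Ω) (m' : MeasurableSpace Ω) (f : Ω → β) (g : Ω → γ) : Prop :=
  ∀ s t, MeasurableSet s → MeasurableSet t →
    (P⟦f ⁻¹' s ∩ g ⁻¹' t | m'⟧) =ᵐ[P] fun ω => (P⟦f ⁻¹' s | m'⟧) ω * (P⟦g ⁻¹' t | m'⟧) ω

/-- The potential outcomes `Ypot d z` of a unit with observation `H` satisfy the identifying
assumptions (common support is part of `Overlap`). The potential outcome of treatment `d` alone is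
`Y^d = Y^{d,Z}`. -/
structure Identifying {Ω 𝒟 𝒵 𝒳 : Type*} [MeasurableSpace Ω]
    [MeasurableSpace 𝒟] [MeasurableSpace 𝒵] [MeasurableSpace 𝒳]
    (P : Measure Ω) (H : Ω → Obs 𝒟 𝒵 𝒳) (Ypot : 𝒟 → 𝒵 → Ω → ℝ) : Prop where
  measurable : ∀ d z, Measurable (Ypot d z)
  integrable : ∀ d z, Integrable (Ypot d z) P
  cia_treat : CondIndepGiven P (MeasurableSpace.comap H (sigmaZX 𝒟 𝒵 𝒳))
    (fun ω d => Ypot d (moder (H ω)) ω) (fun ω => treat (H ω))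
  cia_moder : CondIndepGiven P (MeasurableSpace.comap H (sigmaX 𝒟 𝒵 𝒳))
    (fun ω (q : 𝒟 × 𝒵) => Ypot q.1 q.2 ω) (fun ω => moder (H ω))
  sutva : ∀ᵐ ω ∂P, outcome (H ω) = Ypot (treat (H ω)) (moder (H ω)) ω

end CBGATE

end

/-!
The error `√N (θ̂ - θ)` of the cross-fitted estimator is `N^{-1/2} ∑ᵢ φ(Hᵢ)`, to which the central
limit theorem applies, plus, for each fold and each of the four cells `(d, z)`, the normalized sum
over the fold of `Γ̂_{d,z} - Γ_{d,z}`. By Slutsky's theorem it is enough that these remainders vanish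
in probability (`tendstoZeroInProb_gamma_sub`).

With `ω = π λ` and `ω̂ = π̂ λ̂`, the difference `Γ̂_{d,z} - Γ_{d,z}` is the sum (`gamma_sub_gamma`) of
* `(μ̂ - μ) (1 - 1{D = d, Z = z} / ω)`, which for fixed `μ̂` is centred given `X`, because
  `P(D = d, Z = z | X) = ω(X)` (`IsTrueNuisance.map_restrict_cell`);
* `1{D = d, Z = z} (Y - μ) (1 / ω̂ - 1 / ω)`, which for fixed `ω̂` is centred given `(D, Z, X)`;
* `- 1{D = d, Z = z} (μ̂ - μ) (1 / ω̂ - 1 / ω)`, which is not centred, but a product of two errors.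

Given the folds, the seed and the training observations, the nuisance estimates are fixed and the
fold is an i.i.d. sample (`measure_crossFit_le`). Hence for the first two terms the conditional
second moment of the normalized sum is at most that of one summand, which is small by sup-norm
consistency, overlap and the square integrability of the residual `Y - E[Y | D, Z, X]`; for the
third term the conditional first absolute moment is at most `√N` times that of one summand, which by
the Cauchy–Schwarz inequality is bounded through the products of mean squared errors in the risk
decay assumption. A conditional Markov inequality turns these bounds into convergence in probability.

For the causal interpretation, `E[Γ_{d,z}] = E[1{D = d, Z = z} Y / ω(X)]`, where `Y` may be replaced
by `Y^{d,z}`. Conditional independence given `(Z, X)` replaces `1{D = d}` by `π_d(z, X)`, and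
conditional independence given `X` then replaces `1{Z = z}` by `λ_z(X)`
(`CondIndepGiven.integral_indicator_eq`), which cancels the weight.
-/

namespace CBGATE

/-! ### Convergence to zero in probability -/

section TendstoZeroInProb

variable {Ω : Type*} [MeasurableSpace Ω] {P : Measure Ω}

lemma TendstoZeroInProb.of_ae_le {f g : ℕ → Ω → ℝ≥0∞} (hf : TendstoZeroInProb P f)
    (h : ∀ᵐ ω ∂P, ∀ N, g N ω ≤ f N ω) : TendstoZeroInProb P g := by
  intro ε hε
  refine tendsto_of_tendsto_of_tendsto_of_le_of_le tendsto_const_nhds (hf ε hε)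
    (fun _ => zero_le) fun N => measure_mono_ae ?_
  filter_upwards [h] with ω hω hε'
  exact le_trans (show ε ≤ g N ω from hε') (hω N)

lemma TendstoZeroInProb.comp {f : ℕ → Ω → ℝ≥0∞} (hf : TendstoZeroInProb P f)
    {φ : ℝ≥0∞ → ℝ≥0∞} (hφ : Tendsto φ (𝓝 0) (𝓝 0)) :
    TendstoZeroInProb P fun N ω => φ (f N ω) := by
  intro ε hε
  obtain ⟨δ, hδ, h⟩ := ENNReal.nhds_zero_basis.eventually_iff.1 (hφ.eventually (gt_mem_nhds hε))
  refine tendsto_of_tendsto_of_tendsto_of_le_of_le tendsto_const_nhds (hf δ hδ)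
    (fun _ => zero_le) fun N => measure_mono fun ω hω => ?_
  by_contra hlt
  exact absurd (h (Set.mem_Iio.2 (not_le.1 hlt))) (not_lt.2 hω)

lemma TendstoZeroInProb.const_mul {f : ℕ → Ω → ℝ≥0∞} (hf : TendstoZeroInProb P f) {C : ℝ≥0∞}
    (hC : C ≠ ∞) : TendstoZeroInProb P fun N ω => C * f N ω :=
  hf.comp (φ := fun x => C * x) (by
    simpa using ENNReal.Tendsto.const_mul (tendsto_id (α := ℝ≥0∞) (x := 𝓝 0)) (.inr hC))

lemma TendstoZeroInProb.rpow_const {f : ℕ → Ω → ℝ≥0∞} (hf : TendstoZeroInProb P f) {a : ℝ}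
    (ha : 0 < a) : TendstoZeroInProb P fun N ω => f N ω ^ a :=
  hf.comp (φ := fun x => x ^ a) (by
    simpa [ha] using (ENNReal.continuous_rpow_const (y := a)).tendsto 0)

lemma TendstoZeroInProb.sq {f : ℕ → Ω → ℝ≥0∞} (hf : TendstoZeroInProb P f) :
    TendstoZeroInProb P fun N ω => f N ω ^ 2 := by
  simpa using hf.rpow_const (a := 2) two_pos

lemma TendstoZeroInProb.add {f g : ℕ → Ω → ℝ≥0∞} (hf : TendstoZeroInProb P f)
    (hg : TendstoZeroInProb P g) : TendstoZeroInProb P fun N ω => f N ω + g N ω := by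
  intro ε hε
  have hε2 : 0 < ε / 2 := ENNReal.div_pos hε.ne' (by simp)
  have := (hf _ hε2).add (hg _ hε2)
  rw [add_zero] at this
  refine tendsto_of_tendsto_of_tendsto_of_le_of_le tendsto_const_nhds this
    (fun _ => zero_le) fun N => (measure_mono fun ω hω => ?_).trans (measure_union_le _ _)
  by_contra hlt
  simp only [Set.mem_union, Set.mem_ofPred_eq, not_or, not_le] at hlt
  have := ENNReal.add_lt_add hlt.1 hlt.2
  rw [ENNReal.add_halves] at this
  exact absurd this (not_lt.2 hω)

lemma TendstoZeroInProb.sum {ι : Type*} (s : Finset ι) {f : ι → ℕ → Ω → ℝ≥0∞}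
    (hf : ∀ i ∈ s, TendstoZeroInProb P (f i)) :
    TendstoZeroInProb P fun N ω => ∑ i ∈ s, f i N ω := by
  classical
  induction s using Finset.induction_on with
  | empty =>
    intro ε hε
    simp [hε.ne']
  | insert i s hi ih =>
    simp only [Finset.sum_insert hi]
    exact (hf i (by simp)).add (ih fun j hj => hf j (by simp [hj]))

end TendstoZeroInProb

/-! ### Conditioning on an independent training sample -/

section Conditioning

variable {Ω : Type*} [MeasurableSpace Ω] {P : Measure Ω} [IsProbabilityMeasure P]

/-- Markov's inequality conditionally on `T`, for a nonnegative function of `T` and of an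
independent `G`, on the event `{T ∈ A}`. -/
lemma measure_le_add_of_indepFun {α β : Type*} [MeasurableSpace α] [MeasurableSpace β]
    {T : Ω → α} {G : Ω → β} (hT : Measurable T) (hG : Measurable G) (h : IndepFun T G P)
    {F : α × β → ℝ≥0∞} (hF : Measurable F) {A : Set α} (hA : MeasurableSet A)
    {ε : ℝ≥0∞} (hε : ε ≠ 0) (hε' : ε ≠ ∞) (δ : ℝ≥0∞) :
    P {ω | T ω ∈ A ∧ ε ≤ F (T ω, G ω)} ≤
      P {ω | T ω ∈ A ∧ δ ≤ ∫⁻ g, F (T ω, g) ∂P.map G} + P (T ⁻¹' A) * (δ / ε) := by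
  set V : α → ℝ≥0∞ := fun t => ∫⁻ g, F (t, g) ∂P.map G with hV
  have : IsProbabilityMeasure (P.map G) := Measure.isProbabilityMeasure_map hG.aemeasurable
  have hVm : Measurable V := hF.lintegral_prod_right'
  set B : Set α := A ∩ {t | V t < δ}
  have hB : MeasurableSet B := hA.inter (measurableSet_lt hVm measurable_const)
  have key : P {ω | T ω ∈ B ∧ ε ≤ F (T ω, G ω)} ≤ P (T ⁻¹' A) * (δ / ε) := by
    have h1 : ε * P {ω | T ω ∈ B ∧ ε ≤ F (T ω, G ω)} ≤ P (T ⁻¹' A) * δ := calc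
      _ ≤ ε * P {ω | ε ≤ (B ×ˢ Set.univ).indicator F (T ω, G ω)} := by
        gcongr
        intro hω
        simpa [Set.indicator, hω.1] using hω.2
      _ ≤ ∫⁻ ω, (B ×ˢ Set.univ).indicator F (T ω, G ω) ∂P :=
        mul_meas_ge_le_lintegral ((hF.indicator (hB.prod .univ)).comp (hT.prodMk hG)) _
      _ = ∫⁻ q, (B ×ˢ Set.univ).indicator F q ∂((P.map T).prod (P.map G)) := by
        rw [← h.map_prod_eq_prod_map_map hT.aemeasurable hG.aemeasurable,
          lintegral_map (hF.indicator (hB.prod .univ)) (hT.prodMk hG)]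
      _ = ∫⁻ t, B.indicator V t ∂P.map T := by
        rw [lintegral_prod _ (hF.indicator (hB.prod .univ)).aemeasurable]
        refine lintegral_congr fun t => ?_
        by_cases ht : t ∈ B <;> simp [Set.indicator, ht, hV]
      _ ≤ ∫⁻ t, A.indicator (fun _ => δ) t ∂P.map T := by
        refine lintegral_mono fun t => ?_
        by_cases ht : t ∈ B
        · simpa [Set.indicator, ht, ht.1] using ht.2.le
        · simp [Set.indicator, ht]
      _ = P (T ⁻¹' A) * δ := by
        rw [lintegral_indicator hA, setLIntegral_const, Measure.map_apply hT hA, mul_comm]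
    rw [← mul_div_assoc]
    rw [ENNReal.le_div_iff_mul_le (.inl hε) (.inl hε'), mul_comm]
    exact h1
  refine le_trans (measure_mono ?_) ((measure_union_le _ _).trans (add_le_add_right key _))
  intro ω hω
  by_cases hlt : V (T ω) < δ
  · exact .inr ⟨⟨hω.1, hlt⟩, hω.2⟩
  · exact .inl ⟨hω.1, not_lt.1 hlt⟩

/-- If `A` is independent of `(B, C)` and `B` is independent of `C`, then `(A, B)` is independent
of `C`. -/
lemma indepFun_prodMk_left {α β γ : Type*} [MeasurableSpace α] [MeasurableSpace β]
    [MeasurableSpace γ] {A : Ω → α} {B : Ω → β} {C : Ω → γ} (hA : Measurable A)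
    (hB : Measurable B) (hC : Measurable C) (hABC : IndepFun A (fun ω => (B ω, C ω)) P)
    (hBC : IndepFun B C P) : IndepFun (fun ω => (A ω, B ω)) C P := by
  have hAB : IndepFun A B P := hABC.comp measurable_id measurable_fst
  have := Measure.isProbabilityMeasure_map (μ := P) hA.aemeasurable
  have := Measure.isProbabilityMeasure_map (μ := P) hB.aemeasurable
  have := Measure.isProbabilityMeasure_map (μ := P) hC.aemeasurable
  rw [indepFun_iff_map_prod_eq_prod_map_map (hA.prodMk hB).aemeasurable hC.aemeasurable,
    hAB.map_prod_eq_prod_map_map hA.aemeasurable hB.aemeasurable]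
  have h := hABC.map_prod_eq_prod_map_map hA.aemeasurable (hB.prodMk hC).aemeasurable
  rw [hBC.map_prod_eq_prod_map_map hB.aemeasurable hC.aemeasurable] at h
  rw [← ((measurePreserving_prodAssoc (P.map A) (P.map B) (P.map C)).symm).map_eq, ← h,
    Measure.map_map (MeasurableEquiv.measurable _) (hA.prodMk (hB.prodMk hC))]
  rfl

end Conditioning

/-! ### Moments of normalized sums -/

section Moments

variable {α : Type*} [MeasurableSpace α] {ν : Measure α} [IsProbabilityMeasure ν]

/-- The first moment of `N^{-1/2}` times a sum over at most `N` observations. -/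
lemma lintegral_enorm_inv_sqrt_mul_sum_le {N : ℕ} (J : Finset (Fin N)) {f : α → ℝ}
    (hf : Measurable f) :
    ∫⁻ h, ‖(√(N : ℝ))⁻¹ * ∑ j : J, f (h j)‖ₑ ∂Measure.pi (fun _ : J => ν) ≤
      ENNReal.ofReal (√(N : ℝ)) * ∫⁻ x, ‖f x‖ₑ ∂ν := by
  have hsum : ∫⁻ h, ‖∑ j : J, f (h j)‖ₑ ∂Measure.pi (fun _ : J => ν) ≤
      (N : ℝ≥0∞) * ∫⁻ x, ‖f x‖ₑ ∂ν := calc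
    _ ≤ ∫⁻ h, ∑ j : J, ‖f (h j)‖ₑ ∂Measure.pi (fun _ : J => ν) :=
      lintegral_mono fun h => enorm_sum_le _ _
    _ = ∑ j : J, ∫⁻ h, ‖f (h j)‖ₑ ∂Measure.pi (fun _ : J => ν) :=
      lintegral_finsetSum _ fun j _ => (hf.comp (measurable_pi_apply j)).enorm
    _ = ∑ j : J, ∫⁻ x, ‖f x‖ₑ ∂ν := by
      refine Finset.sum_congr rfl fun j _ => ?_
      exact (measurePreserving_eval (fun _ : J => ν) j).lintegral_comp hf.enorm
    _ ≤ _ := by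
      simp only [Finset.sum_const, nsmul_eq_mul, Finset.card_univ, Fintype.card_coe]
      gcongr
      simpa using J.card_le_univ
  have hN : ‖(√(N : ℝ))⁻¹‖ₑ * (N : ℝ≥0∞) = ENNReal.ofReal (√(N : ℝ)) := by
    rw [Real.enorm_eq_ofReal (by positivity), ← ENNReal.ofReal_natCast,
      ← ENNReal.ofReal_mul (by positivity)]
    congr 1
    rcases Nat.eq_zero_or_pos N with rfl | hN
    · simp
    · rw [inv_mul_eq_div, Real.div_sqrt]
  simp_rw [enorm_mul]
  rw [lintegral_const_mul _ (by fun_prop), ← hN, mul_assoc]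
  gcongr

/-- The second moment of `N^{-1/2}` times a sum of at most `N` centred observations. -/
lemma lintegral_enorm_sq_inv_sqrt_mul_sum_le {N : ℕ} (J : Finset (Fin N)) {f : α → ℝ}
    (hf : Measurable f) (h0 : MemLp f 2 ν → ∫ x, f x ∂ν = 0) :
    ∫⁻ h, ‖(√(N : ℝ))⁻¹ * ∑ j : J, f (h j)‖ₑ ^ 2 ∂Measure.pi (fun _ : J => ν) ≤
      ∫⁻ x, ‖f x‖ₑ ^ 2 ∂ν := by
  rcases J.eq_empty_or_nonempty with rfl | hJ
  · simp
  have hN : 0 < N := by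
    obtain ⟨j, -⟩ := hJ
    exact j.pos
  by_cases hfin : ∫⁻ x, ‖f x‖ₑ ^ 2 ∂ν = ∞
  · rw [hfin]; exact le_top
  have hL2 : MemLp f 2 ν := by
    refine ⟨hf.aestronglyMeasurable, ?_⟩
    rw [eLpNorm_lt_top_iff_lintegral_rpow_enorm_lt_top (by simp) (by simp)]
    simpa using lt_top_iff_ne_top.2 hfin
  have hmean := h0 hL2
  have hLj : ∀ j : J, MemLp (fun h : J → α => f (h j)) 2 (Measure.pi fun _ : J => ν) := fun j =>
    hL2.comp_measurePreserving (measurePreserving_eval (fun _ : J => ν) j)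
  have hsumL : MemLp (∑ j : J, fun h : J → α => f (h j)) 2 (Measure.pi fun _ : J => ν) :=
    memLp_finsetSum' _ fun j _ => hLj j
  have hvar := variance_sum_pi (μ := fun _ : J => ν) (X := fun _ : J => f) fun _ => hL2
  have hsum0 : ∫ h, (∑ j : J, fun h : J → α => f (h j)) h ∂Measure.pi (fun _ : J => ν) = 0 := by
    simp only [Finset.sum_apply]
    rw [integral_finsetSum _ fun j _ => (hLj j).integrable (by norm_num)]
    refine Finset.sum_eq_zero fun j _ => ?_
    rw [integral_comp_eval (μ := fun _ : J => ν) (f := f) hf.aestronglyMeasurable, hmean]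
  rw [variance_of_integral_eq_zero hsumL.aestronglyMeasurable.aemeasurable hsum0] at hvar
  simp only [variance_of_integral_eq_zero hf.aemeasurable hmean, Finset.sum_const,
    Finset.card_univ, Fintype.card_coe, nsmul_eq_mul, Finset.sum_apply] at hvar
  have hsq : ∀ x : ℝ, ‖x‖ₑ ^ 2 = ENNReal.ofReal (x ^ 2) := fun x => by
    rw [← enorm_pow, Real.enorm_eq_ofReal (sq_nonneg x)]
  have hint : Integrable (fun h : J → α => (∑ j : J, f (h j)) ^ 2) (Measure.pi fun _ : J => ν) := by
    simpa using hsumL.integrable_sq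
  simp_rw [enorm_mul, mul_pow, hsq]
  rw [lintegral_const_mul _ (by fun_prop), ← ofReal_integral_eq_lintegral_ofReal hint
    (ae_of_all _ fun _ => sq_nonneg _), hvar, ← ofReal_integral_eq_lintegral_ofReal
    hL2.integrable_sq (ae_of_all _ fun _ => sq_nonneg _), ← ENNReal.ofReal_mul (by positivity)]
  refine ENNReal.ofReal_le_ofReal ?_
  have hcard : (J.card : ℝ) ≤ N := by
    have := J.card_le_univ
    simp only [Fintype.card_fin] at this
    exact_mod_cast this
  have hN' : (0 : ℝ) < N := by exact_mod_cast hN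
  have hI : 0 ≤ ∫ x, f x ^ 2 ∂ν := integral_nonneg fun _ => sq_nonneg _
  rw [inv_pow, Real.sq_sqrt hN'.le, ← mul_assoc]
  refine mul_le_of_le_one_left hI ?_
  rw [inv_mul_le_iff₀ hN']
  simpa using hcard

end Moments

/-! ### Sums over a held-out fold -/

section CrossFit

variable {Ω 𝒟 𝒵 𝒳 𝒰 : Type*} [MeasurableSpace Ω]
  [MeasurableSpace 𝒟] [MeasurableSpace 𝒵] [MeasurableSpace 𝒳] [MeasurableSpace 𝒰]
  {P : Measure Ω} [IsProbabilityMeasure P]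
  {ν : Measure (Obs 𝒟 𝒵 𝒳)}
  {H : ℕ → Ω → Obs 𝒟 𝒵 𝒳} {K : ℕ} {S : (N : ℕ) → Ω → Fin N → Fin K} {U : ℕ → Ω → 𝒰}
  {L : Learner 𝒟 𝒵 𝒳 𝒰}

/-- Markov's inequality for a nonnegative functional `F` of the nuisance functions used on fold `k`
and of the observations in fold `k`. Given the folds, the seed and the training observations, the
fold is an i.i.d. sample from `ν`, so that only the expectation of `F` over such a sample has to be
bounded, by a (not necessarily measurable) function `B` of the fitted nuisance functions. -/
lemma measure_crossFit_le (hH : ∀ i, Measurable (H i)) (hlaw : ∀ i, P.map (H i) = ν)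
    (hindep : iIndepFun H P) (hS : ∀ N, Measurable (S N)) (hU : ∀ N, Measurable (U N))
    (hSU : ∀ N, IndepFun (fun ω => (S N ω, U N ω)) (fun ω i => H i ω) P)
    (N : ℕ) (k : Fin K) (F : Nuisance 𝒟 𝒵 𝒳 → (J : Finset (Fin N)) → (J → Obs 𝒟 𝒵 𝒳) → ℝ≥0∞)
    (B : Nuisance 𝒟 𝒵 𝒳 → ℝ≥0∞)
    (hF : ∀ I J : Finset (Fin N), Measurable
      fun q : ((I → Obs 𝒟 𝒵 𝒳) × 𝒰) × (J → Obs 𝒟 𝒵 𝒳) => F (L.fit N I q.1.1 q.1.2) J q.2)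
    (hB : ∀ (I J : Finset (Fin N)) (t : I → Obs 𝒟 𝒵 𝒳) (r : 𝒰),
      ∫⁻ h, F (L.fit N I t r) J h ∂Measure.pi (fun _ : J => ν) ≤ B (L.fit N I t r))
    {ε : ℝ≥0∞} (hε : ε ≠ 0) (hε' : ε ≠ ∞) (δ : ℝ≥0∞) :
    P {ω | ε ≤ F (crossFit L H U S N k ω) (fold (S N ω) k) fun i => H i.1 ω} ≤
      P {ω | δ ≤ B (crossFit L H U S N k ω)} + δ / ε := by
  have hfib : ∀ s : Fin N → Fin K, MeasurableSet (S N ⁻¹' {s}) := fun s =>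
    hS N (measurableSet_singleton s)
  have hsum : ∀ E : Set Ω, ∑ s, P (S N ⁻¹' {s} ∩ E) = P E := fun E => by
    have := sum_measure_preimage_singleton (μ := P.restrict E) (f := S N) Finset.univ
      fun s _ => hfib s
    simpa [Measure.restrict_apply (hfib _)] using this
  -- the inequality holds on each of the events `S N = s`, where training and held-out index sets
  -- are deterministic
  have key : ∀ s : Fin N → Fin K,
      P (S N ⁻¹' {s} ∩
        {ω | ε ≤ F (crossFit L H U S N k ω) (fold (S N ω) k) fun i => H i.1 ω}) ≤
      P (S N ⁻¹' {s} ∩ {ω | δ ≤ B (crossFit L H U S N k ω)}) + P (S N ⁻¹' {s}) * (δ / ε) := by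
    intro s
    set J := fold s k with hJ
    have hfit : ∀ ω, S N ω = s →
        crossFit L H U S N k ω = L.fit N Jᶜ (fun i => H i.1 ω) (U N ω) := fun ω hω => by
      unfold crossFit
      rw [hω]
    have hFJ : ∀ ω, S N ω = s → F (crossFit L H U S N k ω) (fold (S N ω) k) (fun i => H i.1 ω) =
        F (L.fit N Jᶜ (fun i => H i.1 ω) (U N ω)) J fun i => H i.1 ω := fun ω hω => by
      unfold crossFit
      rw [hω]
    have hHI : ∀ I : Finset (Fin N), Measurable fun ω (i : I) => H i.1 ω := fun I =>
      measurable_pi_lambda _ fun i => hH _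
    have hind : iIndepFun (fun i : Fin N => H i) P := hindep.precomp Fin.val_injective
    have hIJ : IndepFun (fun ω (i : (Jᶜ : Finset (Fin N))) => H i.1 ω)
        (fun ω (i : J) => H i.1 ω) P :=
      hind.indepFun_finset Jᶜ J disjoint_compl_left fun i => hH i
    have hSUJ : IndepFun (fun ω => (S N ω, U N ω))
        (fun ω => ((fun i : (Jᶜ : Finset (Fin N)) => H i.1 ω), fun i : J => H i.1 ω)) P :=
      (hSU N).comp measurable_id (ψ := fun h : ℕ → Obs 𝒟 𝒵 𝒳 =>
        ((fun i : (Jᶜ : Finset (Fin N)) => h i.1), fun i : J => h i.1)) (by fun_prop)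
    have hT := indepFun_prodMk_left ((hS N).prodMk (hU N)) (hHI _) (hHI _) hSUJ hIJ
    have hmapJ : P.map (fun ω (i : J) => H i.1 ω) = Measure.pi fun _ : J => ν := by
      have hJind : iIndepFun (fun i : J => H i.1) P := hind.precomp Subtype.val_injective
      rw [(iIndepFun_iff_map_fun_eq_pi_map fun i : J => (hH i.1).aemeasurable).1 hJind]
      simp only [hlaw]
    have hmain := measure_le_add_of_indepFun (P := P) (((hS N).prodMk (hU N)).prodMk (hHI Jᶜ))
      (hHI J) hT (F := fun q => F (L.fit N Jᶜ q.1.2 q.1.1.2) J q.2)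
      ((hF Jᶜ J).comp (by fun_prop : Measurable fun q : (((Fin N → Fin K) × 𝒰) ×
        ((Jᶜ : Finset (Fin N)) → Obs 𝒟 𝒵 𝒳)) × (J → Obs 𝒟 𝒵 𝒳) => ((q.1.2, q.1.1.2), q.2)))
      (A := {q | q.1.1 = s}) ((measurableSet_singleton s).preimage
        (measurable_fst.comp measurable_fst)) hε hε' δ
    rw [hmapJ] at hmain
    refine le_trans (measure_mono ?_) (hmain.trans (add_le_add_left (measure_mono ?_) _))
    · rintro ω ⟨hω, hωε⟩
      exact ⟨hω, (hFJ ω hω) ▸ hωε⟩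
    · rintro ω ⟨hω, hωδ⟩
      refine ⟨hω, ?_⟩
      have := hωδ.trans (hB Jᶜ J _ _)
      rwa [← hfit ω hω] at this
  calc _ = ∑ s, P (S N ⁻¹' {s} ∩
        {ω | ε ≤ F (crossFit L H U S N k ω) (fold (S N ω) k) fun i => H i.1 ω}) := (hsum _).symm
    _ ≤ ∑ s, (P (S N ⁻¹' {s} ∩ {ω | δ ≤ B (crossFit L H U S N k ω)}) +
        P (S N ⁻¹' {s}) * (δ / ε)) := Finset.sum_le_sum fun s _ => key s
    _ = _ := by
      rw [Finset.sum_add_distrib, hsum, ← Finset.sum_mul]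
      have := hsum Set.univ
      simp only [Set.inter_univ, measure_univ] at this
      rw [this, one_mul]

/-- A functional of the nuisance functions used on fold `k` and of the observations in the fold
tends to zero in probability as soon as a bound for its conditional expectation does. -/
lemma tendstoZeroInProb_crossFit (hH : ∀ i, Measurable (H i)) (hlaw : ∀ i, P.map (H i) = ν)
    (hindep : iIndepFun H P) (hS : ∀ N, Measurable (S N)) (hU : ∀ N, Measurable (U N))
    (hSU : ∀ N, IndepFun (fun ω => (S N ω, U N ω)) (fun ω i => H i ω) P) (k : Fin K)
    (F : (N : ℕ) → Nuisance 𝒟 𝒵 𝒳 → (J : Finset (Fin N)) → (J → Obs 𝒟 𝒵 𝒳) → ℝ≥0∞)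
    (B : ℕ → Nuisance 𝒟 𝒵 𝒳 → ℝ≥0∞)
    (hF : ∀ (N : ℕ) (I J : Finset (Fin N)), Measurable
      fun q : ((I → Obs 𝒟 𝒵 𝒳) × 𝒰) × (J → Obs 𝒟 𝒵 𝒳) => F N (L.fit N I q.1.1 q.1.2) J q.2)
    (hB : ∀ (N : ℕ) (I J : Finset (Fin N)) (t : I → Obs 𝒟 𝒵 𝒳) (r : 𝒰),
      ∫⁻ h, F N (L.fit N I t r) J h ∂Measure.pi (fun _ : J => ν) ≤ B N (L.fit N I t r))
    (hlim : TendstoZeroInProb P fun N ω => B N (crossFit L H U S N k ω)) :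
    TendstoZeroInProb P fun N ω =>
      F N (crossFit L H U S N k ω) (fold (S N ω) k) fun i => H i.1 ω := by
  intro ε hε
  wlog hε' : ε ≠ ∞ generalizing ε
  · refine tendsto_of_tendsto_of_tendsto_of_le_of_le tendsto_const_nhds
      (this 1 one_pos ENNReal.one_ne_top) (fun _ => zero_le) fun N => measure_mono fun ω hω => ?_
    have hω' : ε ≤ _ := hω
    rw [not_not.1 hε'] at hω'
    exact le_trans le_top hω'
  rw [ENNReal.tendsto_nhds_zero]
  intro c hc
  have hc2 : 0 < c / 2 := ENNReal.div_pos hc.ne' (by simp)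
  have hδ : 0 < c / 2 * ε := ENNReal.mul_pos hc2.ne' hε.ne'
  filter_upwards [(ENNReal.tendsto_nhds_zero.1 (hlim _ hδ)) _ hc2] with N hN
  calc _ ≤ _ := measure_crossFit_le hH hlaw hindep hS hU hSU N k (F N) (B N) (hF N) (hB N)
        hε.ne' hε' (c / 2 * ε)
    _ ≤ c / 2 + c / 2 := by
        refine add_le_add hN ?_
        rw [mul_div_assoc]
        exact mul_le_of_le_one_right zero_le ENNReal.div_self_le_one
    _ = c := ENNReal.add_halves c

variable [IsProbabilityMeasure ν]

/-- A normalized sum over fold `k` of terms `G η̂ (H i)` that have mean zero for fixed `η̂` tends to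
zero in probability if the second moment of `G η̂`, for fixed `η̂`, does. -/
lemma tendstoZeroInProb_of_lintegral_sq (hH : ∀ i, Measurable (H i))
    (hlaw : ∀ i, P.map (H i) = ν)
    (hindep : iIndepFun H P) (hS : ∀ N, Measurable (S N)) (hU : ∀ N, Measurable (U N))
    (hSU : ∀ N, IndepFun (fun ω => (S N ω, U N ω)) (fun ω i => H i ω) P) (k : Fin K)
    (G : Nuisance 𝒟 𝒵 𝒳 → Obs 𝒟 𝒵 𝒳 → ℝ)
    (hG : ∀ (N : ℕ) (I : Finset (Fin N)), Measurable
      fun q : ((I → Obs 𝒟 𝒵 𝒳) × 𝒰) × Obs 𝒟 𝒵 𝒳 => G (L.fit N I q.1.1 q.1.2) q.2)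
    (hG0 : ∀ (N : ℕ) (I : Finset (Fin N)) (t : I → Obs 𝒟 𝒵 𝒳) (r : 𝒰),
      MemLp (G (L.fit N I t r)) 2 ν → ∫ h, G (L.fit N I t r) h ∂ν = 0)
    (hlim : TendstoZeroInProb P fun N ω => ∫⁻ h, ‖G (crossFit L H U S N k ω) h‖ₑ ^ 2 ∂ν) :
    TendstoZeroInProb P fun N ω =>
      ‖(√(N : ℝ))⁻¹ * ∑ i ∈ fold (S N ω) k, G (crossFit L H U S N k ω) (H i ω)‖ₑ := by
  have h := tendstoZeroInProb_crossFit hH hlaw hindep hS hU hSU k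
    (F := fun N η J h => ‖(√(N : ℝ))⁻¹ * ∑ j : J, G η (h j)‖ₑ ^ 2)
    (B := fun N η => ∫⁻ h, ‖G η h‖ₑ ^ 2 ∂ν) (L := L) ?_ ?_ hlim
  · refine (h.rpow_const (a := 1 / 2) (by norm_num)).of_ae_le (ae_of_all _ fun ω N => ?_)
    simp only
    rw [← ENNReal.rpow_natCast, ← ENNReal.rpow_mul,
      ← Finset.sum_coe_sort (fold (S N ω) k) fun i => G (crossFit L H U S N k ω) (H i ω)]
    norm_num
  · intro N I J
    refine Measurable.pow_const (Measurable.enorm (Measurable.const_mul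
      (Finset.measurable_sum _ fun j _ => ?_) _)) _
    exact (hG N I).comp (by fun_prop : Measurable fun q : ((I → Obs 𝒟 𝒵 𝒳) × 𝒰) ×
      (J → Obs 𝒟 𝒵 𝒳) => (q.1, q.2 j))
  · intro N I J t r
    exact lintegral_enorm_sq_inv_sqrt_mul_sum_le J
      ((hG N I).comp (measurable_prodMk_left (x := (t, r)))) (hG0 N I t r)

/-- A normalized sum over fold `k` of terms `G η̂ (H i)` tends to zero in probability if the first
absolute moment of `G η̂`, for fixed `η̂`, is `o_p(N^{-1/2})`. -/
lemma tendstoZeroInProb_of_lintegral (hH : ∀ i, Measurable (H i)) (hlaw : ∀ i, P.map (H i) = ν)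
    (hindep : iIndepFun H P) (hS : ∀ N, Measurable (S N)) (hU : ∀ N, Measurable (U N))
    (hSU : ∀ N, IndepFun (fun ω => (S N ω, U N ω)) (fun ω i => H i ω) P) (k : Fin K)
    (G : Nuisance 𝒟 𝒵 𝒳 → Obs 𝒟 𝒵 𝒳 → ℝ)
    (hG : ∀ (N : ℕ) (I : Finset (Fin N)), Measurable
      fun q : ((I → Obs 𝒟 𝒵 𝒳) × 𝒰) × Obs 𝒟 𝒵 𝒳 => G (L.fit N I q.1.1 q.1.2) q.2)
    (hlim : TendstoZeroInProb P fun N ω =>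
      ENNReal.ofReal (√(N : ℝ)) * ∫⁻ h, ‖G (crossFit L H U S N k ω) h‖ₑ ∂ν) :
    TendstoZeroInProb P fun N ω =>
      ‖(√(N : ℝ))⁻¹ * ∑ i ∈ fold (S N ω) k, G (crossFit L H U S N k ω) (H i ω)‖ₑ := by
  have h := tendstoZeroInProb_crossFit hH hlaw hindep hS hU hSU k
    (F := fun N η J h => ‖(√(N : ℝ))⁻¹ * ∑ j : J, G η (h j)‖ₑ)
    (B := fun N η => ENNReal.ofReal (√(N : ℝ)) * ∫⁻ h, ‖G η h‖ₑ ∂ν) (L := L) ?_ ?_ hlim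
  · refine h.of_ae_le (ae_of_all _ fun ω N => ?_)
    rw [← Finset.sum_coe_sort (fold (S N ω) k) fun i => G (crossFit L H U S N k ω) (H i ω)]
  · intro N I J
    refine Measurable.enorm (Measurable.const_mul
      (Finset.measurable_sum _ fun j _ => ?_) _)
    exact (hG N I).comp (by fun_prop : Measurable fun q : ((I → Obs 𝒟 𝒵 𝒳) × 𝒰) ×
      (J → Obs 𝒟 𝒵 𝒳) => (q.1, q.2 j))
  · intro N I J t r
    exact lintegral_enorm_inv_sqrt_mul_sum_le J
      ((hG N I).comp (measurable_prodMk_left (x := (t, r))))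

end CrossFit

/-! ### The true nuisance functions -/

section TrueNuisance

lemma integral_mul_condExp {α : Type*} {m m0 : MeasurableSpace α} {μ : Measure α}
    [IsFiniteMeasure μ] (hm : m ≤ m0) {φ f : α → ℝ} (hφ : StronglyMeasurable[m] φ)
    (hφf : Integrable (fun x => φ x * f x) μ) (hf : Integrable f μ) :
    ∫ x, φ x * (μ[f | m]) x ∂μ = ∫ x, φ x * f x ∂μ := by
  rw [← integral_condExp hm (f := fun x => φ x * f x)]
  exact integral_congr_ae (condExp_mul_of_stronglyMeasurable_left hφ hφf hf).symm

variable {𝒟 𝒵 𝒳 : Type*}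

/-- The propensity `ω_{d,z}(x) = π_d(z,x) λ_z(x)` of the event `D = d, Z = z`. -/
def cellProb (η : Nuisance 𝒟 𝒵 𝒳) (d : 𝒟) (z : 𝒵) (x : 𝒳) : ℝ := η.ps d z x * η.mps z x

lemma Overlap.sq_lt_cellProb {κ : ℝ} (hκ : 0 < κ) {η : Nuisance 𝒟 𝒵 𝒳} (h : Overlap κ η) (d : 𝒟)
    (z : 𝒵) (x : 𝒳) : κ ^ 2 < cellProb η d z x := by
  have h1 := (h.1 d z x).1
  have h2 := (h.2 z x).1
  unfold cellProb
  nlinarith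

lemma Overlap.cellProb_lt {κ : ℝ} (hκ : 0 < κ) {η : Nuisance 𝒟 𝒵 𝒳} (h : Overlap κ η) (d : 𝒟)
    (z : 𝒵) (x : 𝒳) : cellProb η d z x < 1 - κ := by
  have h1 := h.1 d z x
  have h2 := h.2 z x
  unfold cellProb
  nlinarith

lemma Overlap.norm_inv_cellProb_le {κ : ℝ} (hκ : 0 < κ) {η : Nuisance 𝒟 𝒵 𝒳} (h : Overlap κ η)
    (d : 𝒟) (z : 𝒵) (x : 𝒳) : ‖(cellProb η d z x)⁻¹‖ ≤ (κ ^ 2)⁻¹ := by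
  have h1 := h.sq_lt_cellProb hκ d z x
  rw [norm_inv, Real.norm_of_nonneg ((sq_nonneg κ).trans h1.le)]
  gcongr

variable [MeasurableSpace 𝒳]

lemma measurable_sigmaX {f : 𝒳 → ℝ} (hf : Measurable f) :
    Measurable[sigmaX 𝒟 𝒵 𝒳] fun h : Obs 𝒟 𝒵 𝒳 => f (covar h) :=
  hf.comp (comap_measurable _)

variable [MeasurableSpace 𝒵]

lemma measurable_sigmaZX {f : 𝒵 × 𝒳 → ℝ} (hf : Measurable f) :
    Measurable[sigmaZX 𝒟 𝒵 𝒳] fun h : Obs 𝒟 𝒵 𝒳 => f (moder h, covar h) :=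
  hf.comp (comap_measurable _)

variable [MeasurableSpace 𝒟]

lemma measurable_sigmaDZX {f : 𝒟 × 𝒵 × 𝒳 → ℝ} (hf : Measurable f) :
    Measurable[sigmaDZX 𝒟 𝒵 𝒳] fun h : Obs 𝒟 𝒵 𝒳 => f (treat h, moder h, covar h) :=
  hf.comp (comap_measurable _)

lemma sigmaX_le : sigmaX 𝒟 𝒵 𝒳 ≤ (inferInstance : MeasurableSpace (Obs 𝒟 𝒵 𝒳)) :=
  Measurable.comap_le (by fun_prop)

lemma sigmaZX_le : sigmaZX 𝒟 𝒵 𝒳 ≤ (inferInstance : MeasurableSpace (Obs 𝒟 𝒵 𝒳)) :=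
  Measurable.comap_le (by fun_prop)

lemma sigmaDZX_le : sigmaDZX 𝒟 𝒵 𝒳 ≤ (inferInstance : MeasurableSpace (Obs 𝒟 𝒵 𝒳)) :=
  Measurable.comap_le (by fun_prop)

lemma measurableSet_treat_eq [MeasurableSingletonClass 𝒟] (d : 𝒟) :
    MeasurableSet {h : Obs 𝒟 𝒵 𝒳 | treat h = d} :=
  measurable_fst (measurableSet_singleton d)

lemma measurableSet_moder_eq [MeasurableSingletonClass 𝒵] (z : 𝒵) :
    MeasurableSet {h : Obs 𝒟 𝒵 𝒳 | moder h = z} :=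
  (measurable_fst.comp measurable_snd) (measurableSet_singleton z)

lemma measurableSet_cell [MeasurableSingletonClass 𝒟] [MeasurableSingletonClass 𝒵] (d : 𝒟)
    (z : 𝒵) : MeasurableSet {h : Obs 𝒟 𝒵 𝒳 | treat h = d ∧ moder h = z} :=
  (measurableSet_treat_eq d).inter (measurableSet_moder_eq z)

lemma IsTrueNuisance.measurable_cellProb {ν : Measure (Obs 𝒟 𝒵 𝒳)} {η : Nuisance 𝒟 𝒵 𝒳}
    (hη : IsTrueNuisance ν η) (d : 𝒟) (z : 𝒵) : Measurable (cellProb η d z) :=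
  (hη.measurable_ps d z).mul (hη.measurable_mps z)

variable [DecidableEq 𝒟] [DecidableEq 𝒵]

/-- The indicator of the event `D = d, Z = z`. -/
def cellInd (d : 𝒟) (z : 𝒵) (h : Obs 𝒟 𝒵 𝒳) : ℝ := if treat h = d ∧ moder h = z then 1 else 0

omit [MeasurableSpace 𝒟] [MeasurableSpace 𝒵] [MeasurableSpace 𝒳] in
lemma cellInd_nonneg (d : 𝒟) (z : 𝒵) (h : Obs 𝒟 𝒵 𝒳) : 0 ≤ cellInd d z h := by
  unfold cellInd; split_ifs <;> simp

omit [MeasurableSpace 𝒟] [MeasurableSpace 𝒵] [MeasurableSpace 𝒳] in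
lemma cellInd_le_one (d : 𝒟) (z : 𝒵) (h : Obs 𝒟 𝒵 𝒳) : cellInd d z h ≤ 1 := by
  unfold cellInd; split_ifs <;> simp

omit [MeasurableSpace 𝒟] [MeasurableSpace 𝒵] [MeasurableSpace 𝒳] in
lemma gamma_eq (η : Nuisance 𝒟 𝒵 𝒳) (d : 𝒟) (z : 𝒵) (h : Obs 𝒟 𝒵 𝒳) :
    gamma η d z h = η.reg d z (covar h) +
      cellInd d z h * (outcome h - η.reg d z (covar h)) * (cellProb η d z (covar h))⁻¹ := by
  rw [gamma, cellInd, cellProb, div_eq_mul_inv]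

variable {ν : Measure (Obs 𝒟 𝒵 𝒳)} {η : Nuisance 𝒟 𝒵 𝒳}

/-- On the event `D = d, Z = z`, the residual `Y - μ_d(Z,X)` is `Y - E[Y | D, Z, X]`. -/
lemma IsTrueNuisance.cellInd_mul_residual_ae_eq (hη : IsTrueNuisance ν η) (d : 𝒟) (z : 𝒵) :
    (fun h => cellInd d z h * (outcome h - η.reg d z (covar h))) =ᵐ[ν]
      fun h => cellInd d z h * (outcome h - (ν[outcome | sigmaDZX 𝒟 𝒵 𝒳]) h) := by
  filter_upwards [hη.reg_eq] with h hh
  rw [← hh]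
  by_cases hc : treat h = d ∧ moder h = z
  · simp [cellInd, hc.1, hc.2]
  · simp [cellInd, hc]

variable [MeasurableSingletonClass 𝒟] [MeasurableSingletonClass 𝒵]

@[fun_prop]
lemma measurable_cellInd (d : 𝒟) (z : 𝒵) : Measurable (cellInd d z : Obs 𝒟 𝒵 𝒳 → ℝ) :=
  Measurable.ite (measurableSet_cell d z) measurable_const measurable_const

variable [IsProbabilityMeasure ν]

/-- `P(D = d, Z = z, X ∈ B) = E[ω_{d,z}(X) 1{X ∈ B}]`, by the tower property. -/
lemma IsTrueNuisance.integral_cell (hη : IsTrueNuisance ν η) {κ : ℝ} (hκ : 0 < κ)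
    (hov : Overlap κ η) (d : 𝒟) (z : 𝒵) {B : Set 𝒳} (hB : MeasurableSet B) :
    ν.real ({h | treat h = d ∧ moder h = z} ∩ covar ⁻¹' B) =
      ∫ h in covar ⁻¹' B, cellProb η d z (covar h) ∂ν := by
  classical
  have hcov : Measurable (covar : Obs 𝒟 𝒵 𝒳 → 𝒳) := by fun_prop
  set b : 𝒳 → ℝ := B.indicator 1 with hb
  have hbm : Measurable b := measurable_one.indicator hB
  have hb1 : ∀ x, ‖b x‖ ≤ 1 := fun x => by
    by_cases hx : x ∈ B <;> simp [hb, hx]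
  have hint1 : Integrable (({h : Obs 𝒟 𝒵 𝒳 | treat h = d}).indicator (1 : Obs 𝒟 𝒵 𝒳 → ℝ)) ν :=
    (integrable_const (1 : ℝ)).indicator (measurableSet_treat_eq d)
  have hint2 : Integrable (({h : Obs 𝒟 𝒵 𝒳 | moder h = z}).indicator (1 : Obs 𝒟 𝒵 𝒳 → ℝ)) ν :=
    (integrable_const (1 : ℝ)).indicator (measurableSet_moder_eq z)
  have hps : ∀ x, ‖η.ps d z x‖ ≤ 1 := fun x => by
    have := hov.1 d z x
    rw [Real.norm_eq_abs, abs_le]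
    constructor <;> linarith
  have hzm : Measurable fun q : 𝒵 × 𝒳 => (if q.1 = z then (1 : ℝ) else 0) * b q.2 :=
    (Measurable.ite (measurable_fst (measurableSet_singleton z)) measurable_const
      measurable_const).mul (hbm.comp measurable_snd)
  have e1 := integral_mul_condExp (μ := ν) sigmaZX_le
    (φ := fun h : Obs 𝒟 𝒵 𝒳 => (if moder h = z then (1 : ℝ) else 0) * b (covar h))
    (measurable_sigmaZX hzm).stronglyMeasurable
    (hint1.bdd_mul (c := 1) (hzm.comp
      (by fun_prop : Measurable fun h : Obs 𝒟 𝒵 𝒳 => (moder h, covar h))).aestronglyMeasurable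
      (ae_of_all _ fun h => by
        rw [norm_mul]
        refine mul_le_one₀ ?_ (norm_nonneg _) (hb1 _)
        split_ifs <;> simp)) hint1
  have e2 := integral_mul_condExp (μ := ν) sigmaX_le
    (φ := fun h : Obs 𝒟 𝒵 𝒳 => b (covar h) * η.ps d z (covar h))
    (measurable_sigmaX (hbm.mul (hη.measurable_ps d z))).stronglyMeasurable
    (hint2.bdd_mul (c := 1) ((hbm.mul (hη.measurable_ps d z)).comp hcov).aestronglyMeasurable
      (ae_of_all _ fun h => by
        simp only [norm_mul]
        exact mul_le_one₀ (hb1 _) (norm_nonneg _) (hps _))) hint2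
  calc ν.real ({h | treat h = d ∧ moder h = z} ∩ covar ⁻¹' B)
      = ∫ h, ({h | treat h = d ∧ moder h = z} ∩ covar ⁻¹' B).indicator 1 h ∂ν :=
        (integral_indicator_one ((measurableSet_cell d z).inter (hcov hB))).symm
    _ = ∫ h, (if moder h = z then (1 : ℝ) else 0) * b (covar h) *
          ({h : Obs 𝒟 𝒵 𝒳 | treat h = d}).indicator 1 h ∂ν := by
        congr 1 with h
        by_cases h1 : treat h = d <;> by_cases h2 : moder h = z <;> by_cases h3 : covar h ∈ B <;>
          simp [Set.indicator, hb, h1, h2, h3]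
    _ = ∫ h, (if moder h = z then (1 : ℝ) else 0) * b (covar h) *
          η.ps d (moder h) (covar h) ∂ν := by
        rw [← e1]
        refine integral_congr_ae ?_
        filter_upwards [hη.ps_eq d] with h hh
        rw [hh]
        rfl
    _ = ∫ h, b (covar h) * η.ps d z (covar h) *
          ({h : Obs 𝒟 𝒵 𝒳 | moder h = z}).indicator 1 h ∂ν := by
        congr 1 with h
        by_cases h2 : moder h = z <;> simp [Set.indicator, h2]
    _ = ∫ h, b (covar h) * η.ps d z (covar h) * η.mps z (covar h) ∂ν := by
        rw [← e2]
        refine integral_congr_ae ?_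
        filter_upwards [hη.mps_eq z] with h hh
        rw [hh]
        rfl
    _ = ∫ h in covar ⁻¹' B, cellProb η d z (covar h) ∂ν := by
        rw [← integral_indicator (hcov hB)]
        congr 1 with h
        by_cases h3 : covar h ∈ B <;> simp [Set.indicator, hb, h3, cellProb]

/-- On the event `D = d, Z = z`, the covariates have density `ω_{d,z}` with respect to their
law. -/
lemma IsTrueNuisance.map_restrict_cell (hη : IsTrueNuisance ν η) {κ : ℝ} (hκ : 0 < κ)
    (hov : Overlap κ η) (d : 𝒟) (z : 𝒵) :
    (ν.restrict {h | treat h = d ∧ moder h = z}).map covar =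
      (ν.map covar).withDensity fun x => ENNReal.ofReal (cellProb η d z x) := by
  have hcov : Measurable (covar : Obs 𝒟 𝒵 𝒳 → 𝒳) := by fun_prop
  have hw := hη.measurable_cellProb d z
  have hpos : ∀ x, 0 ≤ cellProb η d z x := fun x =>
    (sq_nonneg κ).trans (hov.sq_lt_cellProb hκ d z x).le
  ext B hB
  rw [Measure.map_apply hcov hB, Measure.restrict_apply (hcov hB), withDensity_apply _ hB,
    setLIntegral_map hB hw.ennreal_ofReal hcov, Set.inter_comm]
  rw [← ofReal_integral_eq_lintegral_ofReal _ (ae_of_all _ fun h => hpos _),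
    ← hη.integral_cell hκ hov d z hB, ofReal_measureReal]
  refine Integrable.of_bound (C := 1) (hw.comp hcov).aestronglyMeasurable
    (ae_of_all _ fun h => ?_)
  rw [Real.norm_of_nonneg (hpos _)]
  linarith [hov.cellProb_lt hκ d z (covar h)]

/-- `E[1{D = d, Z = z} f(X)] = E[ω_{d,z}(X) f(X)]`. -/
lemma IsTrueNuisance.integral_cellInd_mul (hη : IsTrueNuisance ν η) {κ : ℝ} (hκ : 0 < κ)
    (hov : Overlap κ η) (d : 𝒟) (z : 𝒵) {f : 𝒳 → ℝ} (hf : Measurable f) :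
    ∫ h, cellInd d z h * f (covar h) ∂ν = ∫ h, cellProb η d z (covar h) * f (covar h) ∂ν := by
  have hcov : Measurable (covar : Obs 𝒟 𝒵 𝒳 → 𝒳) := by fun_prop
  have hw := hη.measurable_cellProb d z
  calc _ = ∫ h in {h | treat h = d ∧ moder h = z}, f (covar h) ∂ν := by
        rw [← integral_indicator (measurableSet_cell d z)]
        congr 1 with h
        by_cases hc : treat h = d ∧ moder h = z <;> simp [cellInd, Set.indicator, hc]
    _ = ∫ x, f x ∂(ν.restrict {h | treat h = d ∧ moder h = z}).map covar :=
        (integral_map hcov.aemeasurable hf.aestronglyMeasurable).symm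
    _ = ∫ x, cellProb η d z x * f x ∂ν.map covar := by
        rw [hη.map_restrict_cell hκ hov, integral_withDensity_eq_integral_toReal_smul
          hw.ennreal_ofReal (ae_of_all _ fun _ => ENNReal.ofReal_lt_top)]
        congr 1 with x
        rw [ENNReal.toReal_ofReal ((sq_nonneg κ).trans (hov.sq_lt_cellProb hκ d z x).le),
          smul_eq_mul]
    _ = _ := integral_map hcov.aemeasurable (hw.mul hf).aestronglyMeasurable

/-- `E[1{D = d, Z = z} f(X)] = E[ω_{d,z}(X) f(X)]` for nonnegative `f`. -/
lemma IsTrueNuisance.lintegral_cellInd_mul (hη : IsTrueNuisance ν η) {κ : ℝ} (hκ : 0 < κ)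
    (hov : Overlap κ η) (d : 𝒟) (z : 𝒵) {f : 𝒳 → ℝ≥0∞} (hf : Measurable f) :
    ∫⁻ h, ENNReal.ofReal (cellInd d z h) * f (covar h) ∂ν =
      ∫⁻ h, ENNReal.ofReal (cellProb η d z (covar h)) * f (covar h) ∂ν := by
  have hcov : Measurable (covar : Obs 𝒟 𝒵 𝒳 → 𝒳) := by fun_prop
  have hw := hη.measurable_cellProb d z
  calc _ = ∫⁻ h in {h | treat h = d ∧ moder h = z}, f (covar h) ∂ν := by
        rw [← lintegral_indicator (measurableSet_cell d z)]
        refine lintegral_congr fun h => ?_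
        by_cases hc : treat h = d ∧ moder h = z <;> simp [cellInd, Set.indicator, hc]
    _ = ∫⁻ x, f x ∂(ν.restrict {h | treat h = d ∧ moder h = z}).map covar :=
        (lintegral_map hf hcov).symm
    _ = ∫⁻ x, ENNReal.ofReal (cellProb η d z x) * f x ∂ν.map covar := by
        rw [hη.map_restrict_cell hκ hov, lintegral_withDensity_eq_lintegral_mul _
          hw.ennreal_ofReal hf]
        rfl
    _ = _ := lintegral_map (hw.ennreal_ofReal.mul hf) hcov

/-- Weighted residuals `1{D = d, Z = z} (Y - μ_d(z,X)) f(X)` have mean zero. -/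
lemma IsTrueNuisance.integral_residual_eq_zero (hη : IsTrueNuisance ν η)
    (hY : Integrable outcome ν) (d : 𝒟) (z : 𝒵) {f : 𝒳 → ℝ} (hf : Measurable f)
    (hint : Integrable
      (fun h => cellInd d z h * (outcome h - η.reg d z (covar h)) * f (covar h)) ν) :
    ∫ h, cellInd d z h * (outcome h - η.reg d z (covar h)) * f (covar h) ∂ν = 0 := by
  set R : Obs 𝒟 𝒵 𝒳 → ℝ := outcome - ν[outcome | sigmaDZX 𝒟 𝒵 𝒳]
  have hR : Integrable R ν := hY.sub integrable_condExp
  have hR0 : ν[R | sigmaDZX 𝒟 𝒵 𝒳] =ᵐ[ν] 0 := by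
    refine (condExp_sub hY integrable_condExp _).trans ?_
    rw [condExp_of_stronglyMeasurable sigmaDZX_le stronglyMeasurable_condExp integrable_condExp,
      sub_self]
  have hcell : Measurable fun q : 𝒟 × 𝒵 × 𝒳 =>
      (if q.1 = d ∧ q.2.1 = z then (1 : ℝ) else 0) * f q.2.2 :=
    (Measurable.ite ((measurable_fst (measurableSet_singleton d)).inter
      ((measurable_fst.comp measurable_snd) (measurableSet_singleton z))) measurable_const
      measurable_const).mul (hf.comp (by fun_prop))
  have hae : (fun h => cellInd d z h * (outcome h - η.reg d z (covar h)) * f (covar h)) =ᵐ[ν]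
      fun h => cellInd d z h * f (covar h) * R h := by
    filter_upwards [hη.cellInd_mul_residual_ae_eq d z] with h hh
    rw [hh]
    simp only [R, Pi.sub_apply]
    ring
  rw [integral_congr_ae hae]
  have := integral_mul_condExp (μ := ν) sigmaDZX_le
    (φ := fun h : Obs 𝒟 𝒵 𝒳 => cellInd d z h * f (covar h))
    (measurable_sigmaDZX hcell).stronglyMeasurable (hint.congr hae) hR
  rw [← this]
  refine integral_eq_zero_of_ae ?_
  filter_upwards [hR0] with h hh
  simp [hh]

/-- By overlap, integrability of the outcome makes every `μ_d(z,X)` integrable. -/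
lemma IsTrueNuisance.integrable_reg (hη : IsTrueNuisance ν η) {κ : ℝ} (hκ : 0 < κ)
    (hov : Overlap κ η) (d : 𝒟) (z : 𝒵) :
    Integrable (fun h => η.reg d z (covar h)) ν := by
  have hcov : Measurable (covar : Obs 𝒟 𝒵 𝒳 → 𝒳) := by fun_prop
  have hreg := hη.measurable_reg d z
  refine ⟨(hreg.comp hcov).aestronglyMeasurable, ?_⟩
  have h1 : ∫⁻ h, ENNReal.ofReal (cellInd d z h) * ‖η.reg d z (covar h)‖ₑ ∂ν < ∞ := by
    refine lt_of_le_of_lt (lintegral_mono_ae ?_)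
      (integrable_condExp (μ := ν) (f := outcome) (m := sigmaDZX 𝒟 𝒵 𝒳)).2
    filter_upwards [hη.reg_eq] with h hh
    rw [← hh]
    by_cases hc : treat h = d ∧ moder h = z
    · simp [cellInd, hc.1, hc.2]
    · simp [cellInd, hc]
  rw [hη.lintegral_cellInd_mul hκ hov d z hreg.enorm] at h1
  have h2 : ENNReal.ofReal (κ ^ 2) * ∫⁻ h, ‖η.reg d z (covar h)‖ₑ ∂ν < ∞ := by
    rw [← lintegral_const_mul _ (by fun_prop)]
    refine lt_of_le_of_lt (lintegral_mono fun h => ?_) h1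
    gcongr
    exact (hov.sq_lt_cellProb hκ d z (covar h)).le
  exact (ENNReal.mul_lt_top_iff.1 h2).elim And.right fun h => by
    rcases h with h | h
    · rw [ENNReal.ofReal_eq_zero] at h
      nlinarith
    · rw [HasFiniteIntegral, h]; exact ENNReal.zero_lt_top

lemma IsTrueNuisance.integrable_weighted_residual (hη : IsTrueNuisance ν η)
    (hY : Integrable outcome ν) {κ : ℝ} (hκ : 0 < κ) (hov : Overlap κ η) (d : 𝒟) (z : 𝒵) :
    Integrable (fun h => cellInd d z h * (outcome h - η.reg d z (covar h)) *
      (cellProb η d z (covar h))⁻¹) ν := by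
  have hcov : Measurable (covar : Obs 𝒟 𝒵 𝒳 → 𝒳) := by fun_prop
  have h1 : Integrable (fun h => cellInd d z h * (outcome h - η.reg d z (covar h))) ν :=
    (hY.sub (hη.integrable_reg hκ hov d z)).bdd_mul (c := 1)
      (measurable_cellInd d z).aestronglyMeasurable (ae_of_all _ fun h => by
        rw [Real.norm_of_nonneg (cellInd_nonneg d z h)]
        exact cellInd_le_one d z h)
  exact h1.mul_bdd (c := (κ ^ 2)⁻¹)
    ((hη.measurable_cellProb d z).inv.comp hcov).aestronglyMeasurable
    (ae_of_all _ fun h => hov.norm_inv_cellProb_le hκ d z _)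

lemma IsTrueNuisance.integrable_gamma (hη : IsTrueNuisance ν η)
    (hY : Integrable outcome ν) {κ : ℝ} (hκ : 0 < κ) (hov : Overlap κ η) (d : 𝒟) (z : 𝒵) :
    Integrable (gamma η d z) ν := by
  refine ((hη.integrable_reg hκ hov d z).add
    (hη.integrable_weighted_residual hY hκ hov d z)).congr (ae_of_all _ fun h => ?_)
  simp only [Pi.add_apply, gamma_eq]

end TrueNuisance

/-! ### The remainder of the estimated score -/

section Remainder

variable {𝒟 𝒵 𝒳 : Type*}

lemma Overlap.enorm_inv_cellProb_sub_le {κ : ℝ} (hκ : 0 < κ) {η η' : Nuisance 𝒟 𝒵 𝒳}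
    (h : Overlap κ η) (h' : Overlap κ η') (d : 𝒟) (z : 𝒵) (x : 𝒳) :
    ‖(cellProb η' d z x)⁻¹ - (cellProb η d z x)⁻¹‖ₑ ≤ ENNReal.ofReal ((κ ^ 2)⁻¹ ^ 2) *
      (‖η'.ps d z x - η.ps d z x‖ₑ + ‖η'.mps z x - η.mps z x‖ₑ) := by
  have hw : cellProb η d z x ≠ 0 := ((sq_nonneg κ).trans_lt (h.sq_lt_cellProb hκ d z x)).ne'
  have hw' : cellProb η' d z x ≠ 0 := ((sq_nonneg κ).trans_lt (h'.sq_lt_cellProb hκ d z x)).ne'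
  have hsub : ‖cellProb η d z x - cellProb η' d z x‖ ≤
      ‖η'.ps d z x - η.ps d z x‖ + ‖η'.mps z x - η.mps z x‖ := by
    have e : cellProb η d z x - cellProb η' d z x =
        (η.ps d z x - η'.ps d z x) * η.mps z x + η'.ps d z x * (η.mps z x - η'.mps z x) := by
      unfold cellProb; ring
    have b1 : ‖η.mps z x‖ ≤ 1 := by
      rw [Real.norm_eq_abs, abs_le]; constructor <;> linarith [h.2 z x]
    have b2 : ‖η'.ps d z x‖ ≤ 1 := by
      rw [Real.norm_eq_abs, abs_le]; constructor <;> linarith [h'.1 d z x]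
    rw [e]
    refine (norm_add_le _ _).trans ?_
    rw [norm_mul, norm_mul, norm_sub_rev (η.ps d z x), norm_sub_rev (η.mps z x)]
    exact add_le_add (mul_le_of_le_one_right (norm_nonneg _) b1)
      (mul_le_of_le_one_left (norm_nonneg _) b2)
  have hreal : ‖(cellProb η' d z x)⁻¹ - (cellProb η d z x)⁻¹‖ ≤ (κ ^ 2)⁻¹ ^ 2 *
      (‖η'.ps d z x - η.ps d z x‖ + ‖η'.mps z x - η.mps z x‖) := by
    rw [inv_sub_inv' hw' hw, norm_mul, norm_mul, mul_right_comm, sq]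
    exact mul_le_mul (mul_le_mul (h'.norm_inv_cellProb_le hκ d z x)
      (h.norm_inv_cellProb_le hκ d z x) (norm_nonneg _) (by positivity)) hsub (norm_nonneg _)
      (by positivity)
  rw [← ofReal_norm, ← ofReal_norm, ← ofReal_norm, ← ENNReal.ofReal_add (norm_nonneg _)
    (norm_nonneg _), ← ENNReal.ofReal_mul (by positivity)]
  exact ENNReal.ofReal_le_ofReal hreal

variable [DecidableEq 𝒟] [DecidableEq 𝒵]

/-- The part of `Γ̂_{d,z} - Γ_{d,z}` that is centred given `X`: the error of the outcome regression,
weighted by `1 - 1{D = d, Z = z} / ω_{d,z}(X)`. -/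
noncomputable def regRemainder (η : Nuisance 𝒟 𝒵 𝒳) (d : 𝒟) (z : 𝒵) (η' : Nuisance 𝒟 𝒵 𝒳)
    (h : Obs 𝒟 𝒵 𝒳) : ℝ :=
  (η'.reg d z (covar h) - η.reg d z (covar h)) *
    (1 - cellInd d z h * (cellProb η d z (covar h))⁻¹)

/-- The part of `Γ̂_{d,z} - Γ_{d,z}` that is centred given `(D, Z, X)`: the residual of the outcome,
weighted by the error of the inverse propensity. -/
noncomputable def psRemainder (η : Nuisance 𝒟 𝒵 𝒳) (d : 𝒟) (z : 𝒵) (η' : Nuisance 𝒟 𝒵 𝒳)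
    (h : Obs 𝒟 𝒵 𝒳) : ℝ :=
  cellInd d z h * (outcome h - η.reg d z (covar h)) *
    ((cellProb η' d z (covar h))⁻¹ - (cellProb η d z (covar h))⁻¹)

/-- The part of `Γ̂_{d,z} - Γ_{d,z}` that is not centred: the product of the errors of the outcome
regression and of the inverse propensity. -/
noncomputable def productRemainder (η : Nuisance 𝒟 𝒵 𝒳) (d : 𝒟) (z : 𝒵) (η' : Nuisance 𝒟 𝒵 𝒳)
    (h : Obs 𝒟 𝒵 𝒳) : ℝ :=
  cellInd d z h * (η.reg d z (covar h) - η'.reg d z (covar h)) *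
    ((cellProb η' d z (covar h))⁻¹ - (cellProb η d z (covar h))⁻¹)

lemma gamma_sub_gamma (η η' : Nuisance 𝒟 𝒵 𝒳) (d : 𝒟) (z : 𝒵) (h : Obs 𝒟 𝒵 𝒳) :
    gamma η' d z h - gamma η d z h =
      regRemainder η d z η' h + psRemainder η d z η' h + productRemainder η d z η' h := by
  rw [gamma_eq, gamma_eq, regRemainder, psRemainder, productRemainder]
  ring

lemma enorm_cellInd_le_one (d : 𝒟) (z : 𝒵) (h : Obs 𝒟 𝒵 𝒳) : ‖cellInd d z h‖ₑ ≤ 1 := by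
  unfold cellInd; split_ifs <;> simp

variable [MeasurableSpace 𝒟] [MeasurableSpace 𝒵] [MeasurableSpace 𝒳]
  {ν : Measure (Obs 𝒟 𝒵 𝒳)} {η η' : Nuisance 𝒟 𝒵 𝒳} {κ : ℝ}

/-- The residual `Y - μ_d(z,X)` on the event `D = d, Z = z` has a finite second moment, being there
equal to `Y - E[Y | D, Z, X]`. -/
lemma IsTrueNuisance.lintegral_sq_residual_lt_top (hη : IsTrueNuisance ν η)
    (hvar : BoundedCondVar ν) (d : 𝒟) (z : 𝒵) :
    ∫⁻ h, ‖cellInd d z h * (outcome h - η.reg d z (covar h))‖ₑ ^ 2 ∂ν < ∞ := by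
  have h1 := (eLpNorm_lt_top_iff_lintegral_rpow_enorm_lt_top (by simp) (by simp)).1 hvar.1.2
  simp only [ENNReal.toReal_ofNat, ENNReal.rpow_ofNat] at h1
  refine lt_of_le_of_lt (lintegral_mono_ae ?_) h1
  filter_upwards [hη.cellInd_mul_residual_ae_eq d z] with h hh
  rw [hh, enorm_mul, Pi.sub_apply]
  gcongr
  exact mul_le_of_le_one_left zero_le (enorm_cellInd_le_one d z h)

lemma lintegral_sq_regRemainder_le [IsProbabilityMeasure ν] (hκ : 0 < κ) (hov : Overlap κ η)
    (η' : Nuisance 𝒟 𝒵 𝒳) (d : 𝒟) (z : 𝒵) :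
    ∫⁻ h, ‖regRemainder η d z η' h‖ₑ ^ 2 ∂ν ≤ (ENNReal.ofReal (1 + (κ ^ 2)⁻¹) *
      ⨆ (z : 𝒵) (x : 𝒳), ‖η'.reg d z x - η.reg d z x‖ₑ) ^ 2 := by
  calc _ ≤ ∫⁻ _, (ENNReal.ofReal (1 + (κ ^ 2)⁻¹) *
        ⨆ (z : 𝒵) (x : 𝒳), ‖η'.reg d z x - η.reg d z x‖ₑ) ^ 2 ∂ν := by
        refine lintegral_mono fun h => ?_
        rw [regRemainder, enorm_mul, mul_comm]
        gcongr
        · rw [← ofReal_norm]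
          refine ENNReal.ofReal_le_ofReal ((norm_sub_le _ _).trans ?_)
          rw [norm_one, norm_mul, Real.norm_of_nonneg (cellInd_nonneg d z h)]
          gcongr
          exact (mul_le_of_le_one_left (norm_nonneg _) (cellInd_le_one d z h)).trans
            (hov.norm_inv_cellProb_le hκ d z _)
        · exact le_iSup₂ (f := fun z x => ‖η'.reg d z x - η.reg d z x‖ₑ) z (covar h)
    _ = _ := by simp

lemma lintegral_sq_psRemainder_le [MeasurableSingletonClass 𝒟] [MeasurableSingletonClass 𝒵]
    (hη : IsTrueNuisance ν η) (hκ : 0 < κ) (hov : Overlap κ η) (hov' : Overlap κ η')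
    (d : 𝒟) (z : 𝒵) :
    ∫⁻ h, ‖psRemainder η d z η' h‖ₑ ^ 2 ∂ν ≤
      (∫⁻ h, ‖cellInd d z h * (outcome h - η.reg d z (covar h))‖ₑ ^ 2 ∂ν) *
      (ENNReal.ofReal ((κ ^ 2)⁻¹ ^ 2) *
        ((⨆ (z : 𝒵) (x : 𝒳), ‖η'.ps d z x - η.ps d z x‖ₑ) +
          ⨆ x : 𝒳, ‖η'.mps z x - η.mps z x‖ₑ)) ^ 2 := by
  have hreg := hη.measurable_reg d z
  rw [← lintegral_mul_const _ (by fun_prop)]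
  refine lintegral_mono fun h => ?_
  rw [psRemainder, enorm_mul _ (_ - _), mul_pow]
  gcongr
  refine (hov.enorm_inv_cellProb_sub_le hκ hov' d z _).trans ?_
  gcongr
  · exact le_iSup₂ (f := fun z x => ‖η'.ps d z x - η.ps d z x‖ₑ) z (covar h)
  · exact le_iSup (fun x => ‖η'.mps z x - η.mps z x‖ₑ) (covar h)

lemma lintegral_enorm_mul_le_sqrt {α : Type*} [MeasurableSpace α] {μ : Measure α} {f g : α → ℝ}
    (hf : Measurable f) (hg : Measurable g) :
    ∫⁻ x, ‖f x‖ₑ * ‖g x‖ₑ ∂μ ≤ ((∫⁻ x, ‖f x‖ₑ ^ 2 ∂μ) * ∫⁻ x, ‖g x‖ₑ ^ 2 ∂μ) ^ (1 / 2 : ℝ) := by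
  have := ENNReal.lintegral_mul_le_Lp_mul_Lq μ Real.HolderConjugate.two_two
    hf.enorm.aemeasurable hg.enorm.aemeasurable
  rw [ENNReal.mul_rpow_of_nonneg _ _ (by norm_num)]
  simpa using this

/-- The product remainder is bounded by the root mean squared errors, by the Cauchy–Schwarz
inequality. -/
lemma lintegral_productRemainder_le [Countable 𝒵] [MeasurableSingletonClass 𝒵]
    (hη : IsTrueNuisance ν η) (hκ : 0 < κ) (hov : Overlap κ η) (hov' : Overlap κ η')
    (d : 𝒟) (z : 𝒵) (hreg : ∀ z, Measurable (η'.reg d z)) (hps : ∀ z, Measurable (η'.ps d z))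
    (hmps : Measurable (η'.mps z)) :
    ∫⁻ h, ‖productRemainder η d z η' h‖ₑ ∂ν ≤ ENNReal.ofReal ((κ ^ 2)⁻¹ ^ 2) *
      ((mse ν (η'.reg d) (η.reg d) * mse ν (η'.ps d) (η.ps d)) ^ (1 / 2 : ℝ) +
        (mse ν (η'.reg d) (η.reg d) *
          mse ν (fun _ => η'.mps z) (fun _ => η.mps z)) ^ (1 / 2 : ℝ)) := by
  have hmeas : ∀ f g : 𝒵 → 𝒳 → ℝ, (∀ z, Measurable (f z)) → (∀ z, Measurable (g z)) →
      Measurable fun h : Obs 𝒟 𝒵 𝒳 => f (moder h) (covar h) - g (moder h) (covar h) :=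
    fun f g hf hg => (measurable_from_prod_countable_right (f := fun q : 𝒵 × 𝒳 =>
      f q.1 q.2 - g q.1 q.2) fun z => (hf z).sub (hg z)).comp
        (by fun_prop : Measurable fun h : Obs 𝒟 𝒵 𝒳 => (moder h, covar h))
  have m1 := hmeas _ _ hreg (hη.measurable_reg d)
  have m2 := hmeas _ _ hps (hη.measurable_ps d)
  have m3 := hmeas _ _ (fun _ => hmps) (fun _ => hη.measurable_mps z)
  calc _ ≤ ∫⁻ h, ENNReal.ofReal ((κ ^ 2)⁻¹ ^ 2) *
        (‖η'.reg d (moder h) (covar h) - η.reg d (moder h) (covar h)‖ₑ *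
            ‖η'.ps d (moder h) (covar h) - η.ps d (moder h) (covar h)‖ₑ +
          ‖η'.reg d (moder h) (covar h) - η.reg d (moder h) (covar h)‖ₑ *
            ‖η'.mps z (covar h) - η.mps z (covar h)‖ₑ) ∂ν := by
        refine lintegral_mono fun h => ?_
        by_cases hc : treat h = d ∧ moder h = z
        · rw [productRemainder, enorm_mul, enorm_mul, hc.2, ← mul_add, mul_left_comm,
            ← neg_sub (η'.reg d z _), enorm_neg]
          exact mul_le_mul' (mul_le_of_le_one_left zero_le (enorm_cellInd_le_one d z h))
            (hov.enorm_inv_cellProb_sub_le hκ hov' d z _)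
        · simp [productRemainder, cellInd, hc]
    _ = ENNReal.ofReal ((κ ^ 2)⁻¹ ^ 2) *
        (∫⁻ h, ‖η'.reg d (moder h) (covar h) - η.reg d (moder h) (covar h)‖ₑ *
            ‖η'.ps d (moder h) (covar h) - η.ps d (moder h) (covar h)‖ₑ ∂ν +
          ∫⁻ h, ‖η'.reg d (moder h) (covar h) - η.reg d (moder h) (covar h)‖ₑ *
            ‖η'.mps z (covar h) - η.mps z (covar h)‖ₑ ∂ν) :=
        (lintegral_const_mul _ ((m1.enorm.mul m2.enorm).add (m1.enorm.mul m3.enorm))).trans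
          (congrArg _ (lintegral_add_left (m1.enorm.mul m2.enorm) _))
    _ ≤ _ := by
        gcongr
        · exact lintegral_enorm_mul_le_sqrt m1 m2
        · exact lintegral_enorm_mul_le_sqrt m1 m3

variable [IsProbabilityMeasure ν] [MeasurableSingletonClass 𝒟] [MeasurableSingletonClass 𝒵]

/-- The regression remainder is centred. Its integrability entails that of `μ̂ - μ`, so
that the two terms of the weight can be integrated separately. -/
lemma IsTrueNuisance.integral_regRemainder (hη : IsTrueNuisance ν η) (hκ : 0 < κ)
    (hov : Overlap κ η) (d : 𝒟) (z : 𝒵) (hreg : Measurable (η'.reg d z))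
    (hint : Integrable (regRemainder η d z η') ν) : ∫ h, regRemainder η d z η' h ∂ν = 0 := by
  have hcov : Measurable (covar : Obs 𝒟 𝒵 𝒳 → 𝒳) := by fun_prop
  set a : 𝒳 → ℝ := fun x => η'.reg d z x - η.reg d z x with ha
  have ham : Measurable a := hreg.sub (hη.measurable_reg d z)
  have hwm := hη.measurable_cellProb d z
  -- the weight `1 - 1{D = d, Z = z} / ω` is bounded away from zero, as `ω < 1 - κ`
  have hlow : ∀ h : Obs 𝒟 𝒵 𝒳, ‖a (covar h)‖ ≤ κ⁻¹ * ‖regRemainder η d z η' h‖ := fun h => by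
    have hw := hov.sq_lt_cellProb hκ d z (covar h)
    have hw1 := hov.cellProb_lt hκ d z (covar h)
    have hw0 : 0 < cellProb η d z (covar h) := (sq_nonneg κ).trans_lt hw
    have hκ1 : κ ≤ 1 := by linarith
    have hge : κ ≤ ‖1 - cellInd d z h * (cellProb η d z (covar h))⁻¹‖ := by
      by_cases hc : treat h = d ∧ moder h = z
      · have h1 : 1 + κ ≤ (cellProb η d z (covar h))⁻¹ := by
          rw [le_inv_comm₀ (by linarith) hw0, ← one_div, le_div_iff₀ (by linarith)]
          nlinarith
        simp only [cellInd, hc, and_self, if_true, one_mul]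
        rw [norm_sub_rev, Real.norm_eq_abs]
        exact le_trans (by linarith) (le_abs_self _)
      · simpa [cellInd, hc] using hκ1
    rw [regRemainder, norm_mul, inv_mul_eq_div, le_div_iff₀ hκ]
    exact mul_le_mul_of_nonneg_left hge (norm_nonneg _)
  have haint : Integrable (fun h => a (covar h)) ν :=
    (hint.norm.const_mul κ⁻¹).mono' (ham.comp hcov).aestronglyMeasurable (ae_of_all _ hlow)
  have hE := hη.integral_cellInd_mul hκ hov d z (f := fun x => a x * (cellProb η d z x)⁻¹)
    (ham.mul hwm.inv)
  have hb : Integrable (fun h : Obs 𝒟 𝒵 𝒳 => cellInd d z h *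
      (a (covar h) * (cellProb η d z (covar h))⁻¹)) ν :=
    (haint.mul_bdd (c := (κ ^ 2)⁻¹) (hwm.inv.comp hcov).aestronglyMeasurable
      (ae_of_all _ fun h => hov.norm_inv_cellProb_le hκ d z _)).bdd_mul (c := 1)
      (measurable_cellInd d z).aestronglyMeasurable (ae_of_all _ fun h => by
        rw [Real.norm_of_nonneg (cellInd_nonneg d z h)]
        exact cellInd_le_one d z h)
  calc ∫ h, regRemainder η d z η' h ∂ν = ∫ h, (a (covar h) - cellInd d z h *
        (a (covar h) * (cellProb η d z (covar h))⁻¹)) ∂ν := by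
        congr 1 with h
        simp only [regRemainder, ha]
        ring
    _ = 0 := by
        rw [integral_sub haint hb, hE, sub_eq_zero]
        congr 1 with h
        have := ((sq_nonneg κ).trans_lt (hov.sq_lt_cellProb hκ d z (covar h))).ne'
        field_simp

lemma IsTrueNuisance.integral_psRemainder (hη : IsTrueNuisance ν η) (hY : Integrable outcome ν)
    (d : 𝒟) (z : 𝒵) (hw : Measurable (cellProb η' d z))
    (hint : Integrable (psRemainder η d z η') ν) : ∫ h, psRemainder η d z η' h ∂ν = 0 :=
  hη.integral_residual_eq_zero hY d z
    (f := fun x => (cellProb η' d z x)⁻¹ - (cellProb η d z x)⁻¹)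
    (hw.inv.sub (hη.measurable_cellProb d z).inv) hint

end Remainder

section CrossFitRemainder

variable {Ω 𝒟 𝒵 𝒳 𝒰 : Type*} [MeasurableSpace Ω]
  [MeasurableSpace 𝒟] [MeasurableSpace 𝒵] [MeasurableSpace 𝒳] [MeasurableSpace 𝒰]
  {L : Learner 𝒟 𝒵 𝒳 𝒰}

lemma Learner.measurable_reg_obs (L : Learner 𝒟 𝒵 𝒳 𝒰) (N : ℕ) (I : Finset (Fin N)) (d : 𝒟)
    (z : 𝒵) : Measurable fun q : ((I → Obs 𝒟 𝒵 𝒳) × 𝒰) × Obs 𝒟 𝒵 𝒳 =>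
      (L.fit N I q.1.1 q.1.2).reg d z (covar q.2) :=
  (L.measurable_reg N I d z).comp (by fun_prop : Measurable
    fun q : ((I → Obs 𝒟 𝒵 𝒳) × 𝒰) × Obs 𝒟 𝒵 𝒳 => (q.1.1, q.1.2, covar q.2))

lemma Learner.measurable_cellProb_obs (L : Learner 𝒟 𝒵 𝒳 𝒰) (N : ℕ) (I : Finset (Fin N)) (d : 𝒟)
    (z : 𝒵) : Measurable fun q : ((I → Obs 𝒟 𝒵 𝒳) × 𝒰) × Obs 𝒟 𝒵 𝒳 =>
      cellProb (L.fit N I q.1.1 q.1.2) d z (covar q.2) :=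
  ((L.measurable_ps N I d z).mul (L.measurable_mps N I z)).comp (by fun_prop : Measurable
    fun q : ((I → Obs 𝒟 𝒵 𝒳) × 𝒰) × Obs 𝒟 𝒵 𝒳 => (q.1.1, q.1.2, covar q.2))

lemma Learner.measurable_fit_reg (L : Learner 𝒟 𝒵 𝒳 𝒰) (N : ℕ) (I : Finset (Fin N))
    (t : I → Obs 𝒟 𝒵 𝒳) (r : 𝒰) (d : 𝒟) (z : 𝒵) : Measurable ((L.fit N I t r).reg d z) :=
  (L.measurable_reg N I d z).comp (by fun_prop : Measurable fun x : 𝒳 => (t, r, x))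

lemma Learner.measurable_fit_ps (L : Learner 𝒟 𝒵 𝒳 𝒰) (N : ℕ) (I : Finset (Fin N))
    (t : I → Obs 𝒟 𝒵 𝒳) (r : 𝒰) (d : 𝒟) (z : 𝒵) : Measurable ((L.fit N I t r).ps d z) :=
  (L.measurable_ps N I d z).comp (by fun_prop : Measurable fun x : 𝒳 => (t, r, x))

lemma Learner.measurable_fit_mps (L : Learner 𝒟 𝒵 𝒳 𝒰) (N : ℕ) (I : Finset (Fin N))
    (t : I → Obs 𝒟 𝒵 𝒳) (r : 𝒰) (z : 𝒵) : Measurable ((L.fit N I t r).mps z) :=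
  (L.measurable_mps N I z).comp (by fun_prop : Measurable fun x : 𝒳 => (t, r, x))

variable [Countable 𝒵] [DecidableEq 𝒟] [DecidableEq 𝒵]
  [MeasurableSingletonClass 𝒟] [MeasurableSingletonClass 𝒵]
  {P : Measure Ω} [IsProbabilityMeasure P]
  {ν : Measure (Obs 𝒟 𝒵 𝒳)} [IsProbabilityMeasure ν]
  {H : ℕ → Ω → Obs 𝒟 𝒵 𝒳} {K : ℕ} {S : (N : ℕ) → Ω → Fin N → Fin K} {U : ℕ → Ω → 𝒰}
  {η : Nuisance 𝒟 𝒵 𝒳} {κ : ℝ}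

/-- On every fold, estimating the nuisance functions changes `N^{-1/2} ∑ Γ_{d,z}(H_i)` by
`o_p(1)`. -/
lemma tendstoZeroInProb_gamma_sub (hH : ∀ i, Measurable (H i)) (hlaw : ∀ i, P.map (H i) = ν)
    (hindep : iIndepFun H P) (hY : Integrable outcome ν) (hη : IsTrueNuisance ν η)
    (hS : ∀ N, Measurable (S N)) (hU : ∀ N, Measurable (U N))
    (hSU : ∀ N, IndepFun (fun ω => (S N ω, U N ω)) (fun ω i => H i ω) P)
    (hκ : 0 < κ) (hov : Overlap κ η) (k : Fin K)
    (hov_est : ∀ᵐ ω ∂P, ∀ N, Overlap κ (crossFit L H U S N k ω))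
    (hcons : Consistent P (fun N ω => crossFit L H U S N k ω) η)
    (hrisk : RiskDecay P ν (fun N ω => crossFit L H U S N k ω) η)
    (hvar : BoundedCondVar ν) (d : 𝒟) (z : 𝒵) :
    TendstoZeroInProb P fun N ω => ‖(√(N : ℝ))⁻¹ * ∑ i ∈ fold (S N ω) k,
      (gamma (crossFit L H U S N k ω) d z (H i ω) - gamma η d z (H i ω))‖ₑ := by
  have hcov : Measurable (covar : Obs 𝒟 𝒵 𝒳 → 𝒳) := by fun_prop
  have hreg := (hη.measurable_reg d z).comp hcov
  have hw := ((hη.measurable_cellProb d z).comp hcov).inv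
  have hcell := measurable_cellInd (𝒳 := 𝒳) d z
  have hout : Measurable (outcome : Obs 𝒟 𝒵 𝒳 → ℝ) := by fun_prop
  have h1 := tendstoZeroInProb_of_lintegral_sq (L := L) hH hlaw hindep hS hU hSU k
    (regRemainder η d z)
    (fun N I => ((L.measurable_reg_obs N I d z).sub (hreg.comp measurable_snd)).mul
      (measurable_const.sub ((hcell.mul hw).comp measurable_snd)))
    (fun N I t r hL => hη.integral_regRemainder hκ hov d z (L.measurable_fit_reg N I t r d z)
      (hL.integrable (by norm_num)))
    (((hcons.reg d).const_mul ENNReal.ofReal_ne_top).sq.of_ae_le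
      (ae_of_all _ fun ω N => lintegral_sq_regRemainder_le hκ hov _ d z))
  have h2 := tendstoZeroInProb_of_lintegral_sq (L := L) hH hlaw hindep hS hU hSU k
    (psRemainder η d z)
    (fun N I => ((hcell.mul (hout.sub hreg)).comp measurable_snd).mul
      ((L.measurable_cellProb_obs N I d z).inv.sub (hw.comp measurable_snd)))
    (fun N I t r hL => hη.integral_psRemainder hY d z
      ((L.measurable_fit_ps N I t r d z).mul (L.measurable_fit_mps N I t r z))
      (hL.integrable (by norm_num)))
    (((((hcons.ps d).add (hcons.mps z)).const_mul ENNReal.ofReal_ne_top).sq.const_mul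
      (hη.lintegral_sq_residual_lt_top hvar d z).ne).of_ae_le (by
        filter_upwards [hov_est] with ω hω N
        exact lintegral_sq_psRemainder_le hη hκ hov (hω N) d z))
  have h3 := tendstoZeroInProb_of_lintegral (L := L) hH hlaw hindep hS hU hSU k
    (productRemainder η d z)
    (fun N I => ((hcell.comp measurable_snd).mul ((hreg.comp measurable_snd).sub
      (L.measurable_reg_obs N I d z))).mul
      ((L.measurable_cellProb_obs N I d z).inv.sub (hw.comp measurable_snd)))
    (((((hrisk.reg_ps d).rpow_const (a := 1 / 2) (by norm_num)).add
      ((hrisk.reg_mps d z).rpow_const (a := 1 / 2) (by norm_num))).const_mul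
        (C := ENNReal.ofReal ((κ ^ 2)⁻¹ ^ 2)) ENNReal.ofReal_ne_top).of_ae_le (by
        filter_upwards [hov_est] with ω hω N
        have hN : ENNReal.ofReal (√(N : ℝ)) = (N : ℝ≥0∞) ^ (1 / 2 : ℝ) := by
          rw [Real.sqrt_eq_rpow, ← ENNReal.ofReal_rpow_of_nonneg (by positivity) (by norm_num),
            ENNReal.ofReal_natCast]
        rw [ENNReal.mul_rpow_of_nonneg _ _ (by norm_num),
          ENNReal.mul_rpow_of_nonneg (N : ℝ≥0∞) (_ * mse ν (fun _ => _) _) (by norm_num),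
          ← mul_add, mul_left_comm, hN]
        gcongr
        exact lintegral_productRemainder_le hη hκ hov (hω N) d z
          (L.measurable_fit_reg N _ _ _ d) (L.measurable_fit_ps N _ _ _ d)
          (L.measurable_fit_mps N _ _ _ z)))
  refine ((h1.add h2).add h3).of_ae_le (ae_of_all _ fun ω N => ?_)
  simp_rw [gamma_sub_gamma, Finset.sum_add_distrib, mul_add]
  exact (enorm_add_le _ _).trans (add_le_add_left (enorm_add_le _ _) _)

end CrossFitRemainder

/-! ### Asymptotic normality -/

section Normality

variable {Ω 𝒟 𝒵 𝒳 𝒰 : Type*} [MeasurableSpace Ω]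
  [MeasurableSpace 𝒟] [MeasurableSpace 𝒵] [MeasurableSpace 𝒳] [MeasurableSpace 𝒰]
  [DecidableEq 𝒟] [DecidableEq 𝒵]
  {H : ℕ → Ω → Obs 𝒟 𝒵 𝒳} {K : ℕ} {S : (N : ℕ) → Ω → Fin N → Fin K} {U : ℕ → Ω → 𝒰}
  {L : Learner 𝒟 𝒵 𝒳 𝒰}

omit [MeasurableSpace Ω] in
lemma Learner.measurable_contrast [MeasurableSingletonClass 𝒟] [MeasurableSingletonClass 𝒵]
    (L : Learner 𝒟 𝒵 𝒳 𝒰) (l m : 𝒟) (u v : 𝒵) (N : ℕ) (I : Finset (Fin N)) :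
    Measurable fun q : ((I → Obs 𝒟 𝒵 𝒳) × 𝒰) × Obs 𝒟 𝒵 𝒳 =>
      contrast (L.fit N I q.1.1 q.1.2) l m u v q.2 := by
  have hg : ∀ d z, Measurable fun q : ((I → Obs 𝒟 𝒵 𝒳) × 𝒰) × Obs 𝒟 𝒵 𝒳 =>
      gamma (L.fit N I q.1.1 q.1.2) d z q.2 := fun d z => by
    simp_rw [gamma_eq]
    have hr := L.measurable_reg_obs N I d z
    have hw := L.measurable_cellProb_obs N I d z
    have hout : Measurable fun q : ((I → Obs 𝒟 𝒵 𝒳) × 𝒰) × Obs 𝒟 𝒵 𝒳 => outcome q.2 := by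
      fun_prop
    exact hr.add ((((measurable_cellInd d z).comp measurable_snd).mul (hout.sub hr)).mul hw.inv)
  exact (((hg l u).sub (hg m u)).sub (hg l v)).add (hg m v)

lemma measurable_estimator [MeasurableSingletonClass 𝒟] [MeasurableSingletonClass 𝒵]
    (hH : ∀ i, Measurable (H i)) (hS : ∀ N, Measurable (S N))
    (hU : ∀ N, Measurable (U N)) (l m : 𝒟) (u v : 𝒵) (N : ℕ) :
    Measurable (estimator L H U S l m u v N) := by
  have hc : ∀ (I : Finset (Fin N)) (i : Fin N), Measurable fun ω =>
      contrast (L.fit N I (fun i => H i.1 ω) (U N ω)) l m u v (H i ω) := fun I i =>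
    (L.measurable_contrast l m u v N I).comp
      (((measurable_pi_lambda (fun ω (i : I) => H i.1 ω) fun i => hH _).prodMk (hU N)).prodMk
        (hH i))
  have hsum : ∀ s : Fin N → Fin K, Measurable fun ω => ∑ k : Fin K, ∑ i ∈ fold s k,
      contrast (L.fit N (fold s k)ᶜ (fun i => H i.1 ω) (U N ω)) l m u v (H i ω) := fun s =>
    Finset.measurable_sum _ fun k _ => Finset.measurable_sum _ fun i _ => hc _ i
  have h := (measurable_from_prod_countable_right (f := fun q : (Fin N → Fin K) × Ω =>
    ∑ k : Fin K, ∑ i ∈ fold q.1 k, contrast (L.fit N (fold q.1 k)ᶜ (fun i => H i.1 q.2)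
      (U N q.2)) l m u v (H i q.2)) hsum).comp ((hS N).prodMk measurable_id)
  exact h.const_mul _

omit [MeasurableSpace Ω] in
/-- The error of the estimator is the normalized sum of the true scores plus, for each fold, a
remainder due to the estimation of the nuisance functions. -/
lemma sqrt_mul_estimator_sub (η : Nuisance 𝒟 𝒵 𝒳) (l m : 𝒟) (u v : 𝒵) (θ : ℝ) (N : ℕ) (ω : Ω) :
    √(N : ℝ) * (estimator L H U S l m u v N ω - θ) -
      (√(N : ℝ))⁻¹ * (∑ i ∈ Finset.range N, contrast η l m u v (H i ω) - N * θ) =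
    ∑ k : Fin K, (√(N : ℝ))⁻¹ * ∑ i ∈ fold (S N ω) k,
      (contrast (crossFit L H U S N k ω) l m u v (H i ω) - contrast η l m u v (H i ω)) := by
  rcases Nat.eq_zero_or_pos N with rfl | hN
  · simp
  have hN' : (0 : ℝ) < N := by exact_mod_cast hN
  have hsum : ∑ i ∈ Finset.range N, contrast η l m u v (H i ω) =
      ∑ k : Fin K, ∑ i ∈ fold (S N ω) k, contrast η l m u v (H i ω) := by
    rw [← Fin.sum_univ_eq_sum_range fun i => contrast η l m u v (H i ω)]
    exact (Finset.sum_fiberwise _ _ _).symm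
  rw [hsum, ← Finset.mul_sum]
  simp_rw [Finset.sum_sub_distrib]
  rw [estimator]
  have h1 : √(N : ℝ) * (1 / (N : ℝ)) = (√(N : ℝ))⁻¹ := by
    rw [mul_one_div, Real.sqrt_div_self', one_div]
  have h2 : (√(N : ℝ))⁻¹ * N = √(N : ℝ) := by
    rw [inv_mul_eq_div, Real.div_sqrt]
  rw [mul_sub, ← mul_assoc, h1, mul_sub, mul_sub, ← mul_assoc, h2]
  ring

variable [Countable 𝒵] [MeasurableSingletonClass 𝒟] [MeasurableSingletonClass 𝒵]
  {P : Measure Ω} [IsProbabilityMeasure P]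
  {ν : Measure (Obs 𝒟 𝒵 𝒳)} [IsProbabilityMeasure ν]
  {η : Nuisance 𝒟 𝒵 𝒳} {κ : ℝ}

omit [Countable 𝒵] [MeasurableSingletonClass 𝒟] [MeasurableSingletonClass 𝒵] in
/-- The central limit theorem for the estimator with known nuisance functions. -/
lemma tendstoInDistribution_contrast (hH : ∀ i, Measurable (H i)) (hlaw : ∀ i, P.map (H i) = ν)
    (hindep : iIndepFun H P) (l m : 𝒟) (u v : 𝒵) (hc : Measurable (contrast η l m u v))
    (hφ : MemLp (score l m u v (estimand ν η l m u v) η) 2 ν) :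
    TendstoInDistribution (fun (N : ℕ) ω => (√(N : ℝ))⁻¹ *
        (∑ i ∈ Finset.range N, contrast η l m u v (H i ω) - N * estimand ν η l m u v))
      atTop id (fun _ => P)
      (gaussianReal 0 (∫ h, score l m u v (estimand ν η l m u v) η h ^ 2 ∂ν).toNNReal) := by
  set θ := estimand ν η l m u v with hθ
  have hcL : MemLp (contrast η l m u v) 2 ν := by
    convert hφ.add (memLp_const θ) using 1
    ext h
    simp [score]
  have hmp : ∀ i, MeasurePreserving (H i) P ν := fun i => ⟨hH i, hlaw i⟩
  have hmean : P[fun ω => contrast η l m u v (H 0 ω)] = θ := by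
    rw [hθ, estimand, ← hlaw 0, integral_map (hH 0).aemeasurable hc.aestronglyMeasurable]
  have hVar : Var[fun ω => contrast η l m u v (H 0 ω); P] =
      ∫ h, score l m u v θ η h ^ 2 ∂ν := by
    rw [variance_eq_integral (X := fun ω => contrast η l m u v (H 0 ω))
      (hc.comp (hH 0)).aemeasurable, hmean, ← hlaw 0,
      integral_map (f := fun h => score l m u v θ η h ^ 2) (hH 0).aemeasurable
        (((hc.sub_const θ).pow_const 2).aestronglyMeasurable)]
    rfl
  have := tendstoInDistribution_inv_sqrt_mul_sum_sub (P := P)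
    (P' := gaussianReal 0 (∫ h, score l m u v θ η h ^ 2 ∂ν).toNNReal)
    (X := fun i ω => contrast η l m u v (H i ω)) (Y := id)
    (by rw [hVar]; exact HasLaw.id) (hcL.comp_measurePreserving (hmp 0))
    (hindep.comp (fun _ => contrast η l m u v) fun _ => hc)
    (fun i => (IdentDistrib.mk (hH i).aemeasurable (hH 0).aemeasurable
      (by rw [hlaw, hlaw])).comp hc)
  rwa [hmean] at this

omit [Countable 𝒵] [IsProbabilityMeasure ν] in
lemma IsTrueNuisance.measurable_contrast (hη : IsTrueNuisance ν η) (l m : 𝒟) (u v : 𝒵) :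
    Measurable (contrast η l m u v) := by
  have hg : ∀ d z, Measurable (gamma η d z) := fun d z => by
    have hr := hη.measurable_reg d z
    have hw := hη.measurable_cellProb d z
    have : gamma η d z = fun h => η.reg d z (covar h) +
      cellInd d z h * (outcome h - η.reg d z (covar h)) * (cellProb η d z (covar h))⁻¹ :=
      funext (gamma_eq η d z)
    rw [this]
    fun_prop
  exact (((hg l u).sub (hg m u)).sub (hg l v)).add (hg m v)

/-- The cross-fitted estimator is asymptotically normal. -/
lemma tendstoInDistribution_estimator (hH : ∀ i, Measurable (H i)) (hlaw : ∀ i, P.map (H i) = ν)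
    (hindep : iIndepFun H P) (hY : Integrable outcome ν) (hη : IsTrueNuisance ν η)
    (hS : ∀ N, Measurable (S N)) (hU : ∀ N, Measurable (U N))
    (hSU : ∀ N, IndepFun (fun ω => (S N ω, U N ω)) (fun ω i => H i ω) P)
    (hκ : 0 < κ) (hov : Overlap κ η)
    (hov_est : ∀ᵐ ω ∂P, ∀ N k, Overlap κ (crossFit L H U S N k ω))
    (hcons : ∀ k, Consistent P (fun N ω => crossFit L H U S N k ω) η)
    (hrisk : ∀ k, RiskDecay P ν (fun N ω => crossFit L H U S N k ω) η)
    (hvar : BoundedCondVar ν) (l m : 𝒟) (u v : 𝒵)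
    (hφ : MemLp (score l m u v (estimand ν η l m u v) η) 2 ν) :
    TendstoInDistribution
      (fun (N : ℕ) ω => √(N : ℝ) * (estimator L H U S l m u v N ω - estimand ν η l m u v))
      atTop id (fun _ => P)
      (gaussianReal 0 (∫ h, score l m u v (estimand ν η l m u v) η h ^ 2 ∂ν).toNNReal) := by
  refine tendstoInDistribution_of_tendstoInMeasure_sub _ _
    (tendstoInDistribution_contrast hH hlaw hindep l m u v (hη.measurable_contrast l m u v) hφ)
    ?_ fun N => (((measurable_estimator hH hS hU l m u v N).sub_const _).const_mul _).aemeasurable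
  have hrem := fun k d z => tendstoZeroInProb_gamma_sub hH hlaw hindep hY hη hS hU hSU hκ hov k
    (hov_est.mono fun ω h N => h N k) (hcons k) (hrisk k) hvar d z
  have hsum := TendstoZeroInProb.sum Finset.univ fun (k : Fin K) _ =>
    (((hrem k l u).add (hrem k m u)).add (hrem k l v)).add (hrem k m v)
  rw [tendstoInMeasure_iff_enorm]
  refine fun ε hε _ => (hsum.of_ae_le (g := fun N ω => _) (ae_of_all _ fun ω N => ?_)) ε hε
  simp only [Pi.sub_apply, Pi.zero_apply, sub_zero]
  rw [sqrt_mul_estimator_sub]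
  refine (enorm_sum_le _ _).trans (Finset.sum_le_sum fun k _ => ?_)
  have e : ∀ i : Fin N, contrast (crossFit L H U S N k ω) l m u v (H i ω) -
      contrast η l m u v (H i ω) =
      (gamma (crossFit L H U S N k ω) l u (H i ω) - gamma η l u (H i ω)) -
      (gamma (crossFit L H U S N k ω) m u (H i ω) - gamma η m u (H i ω)) -
      (gamma (crossFit L H U S N k ω) l v (H i ω) - gamma η l v (H i ω)) +
      (gamma (crossFit L H U S N k ω) m v (H i ω) - gamma η m v (H i ω)) := fun i => by
    simp only [contrast]
    ring
  simp_rw [e, Finset.sum_add_distrib, Finset.sum_sub_distrib, mul_add, mul_sub]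
  refine (enorm_add_le _ _).trans (add_le_add_left ?_ _)
  refine enorm_sub_le.trans (add_le_add_left ?_ _)
  exact enorm_sub_le

end Normality

/-! ### Identification of the causal effect -/

section Identification

variable {Ω : Type*} {m' : MeasurableSpace Ω} [mΩ : MeasurableSpace Ω] {P : Measure Ω}
  [IsProbabilityMeasure P]

/-- Conditional expectations are transported by a map `H` to its law. -/
lemma condExp_comp_ae_eq {α : Type*} {m mα : MeasurableSpace α} {ν : Measure α}
    [IsProbabilityMeasure ν] (hm : m ≤ mα) {H : Ω → α} (hH : MeasurePreserving H P ν)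
    {f : α → ℝ} (hf : Integrable f ν) :
    (fun ω => (ν[f | m]) (H ω)) =ᵐ[P] P[fun ω => f (H ω) | m.comap H] := by
  have hle : m.comap H ≤ mΩ := (MeasurableSpace.comap_mono hm).trans hH.measurable.comap_le
  refine ae_eq_condExp_of_forall_setIntegral_eq hle (hH.integrable_comp_of_integrable hf)
    (fun s _ _ => (hH.integrable_comp_of_integrable integrable_condExp).integrableOn) ?_
    (stronglyMeasurable_condExp.measurable.comp
      (comap_measurable H)).stronglyMeasurable.aestronglyMeasurable
  rintro s ⟨t, ht, rfl⟩ -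
  have h := setIntegral_condExp hm hf ht
  rw [← hH.map_eq] at h
  rw [setIntegral_map (hm t ht) _ hH.measurable.aemeasurable,
    setIntegral_map (hm t ht) _ hH.measurable.aemeasurable] at h
  · rw [hH.map_eq] at h
    exact h
  · rw [hH.map_eq]; exact hf.aestronglyMeasurable
  · rw [hH.map_eq]; exact integrable_condExp.aestronglyMeasurable

/-- If `f` and `g` are conditionally independent given `m'`, then in an expectation involving
functions of `f` and `m'`-measurable weights `φ`, the indicator of `{g ∈ t}` can be replaced by a
version `p` of its conditional probability given `m'`. -/
lemma CondIndepGiven.integral_indicator_eq {β γ : Type*} [MeasurableSpace β] [MeasurableSpace γ]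
    (hm : m' ≤ mΩ) {f : Ω → β} {g : Ω → γ} (h : CondIndepGiven P m' f g)
    (hf : Measurable f) (hg : Measurable g) {t : Set γ} (ht : MeasurableSet t)
    {p φ : Ω → ℝ} (hp : Measurable[m'] p) (hp1 : ∀ ω, ‖p ω‖ ≤ 1) (hpt : p =ᵐ[P] P⟦g ⁻¹' t | m'⟧)
    (hφ : Measurable[m'] φ) {C : ℝ} (hφC : ∀ ω, ‖φ ω‖ ≤ C) {ψ : β → ℝ} (hψ : Measurable ψ)
    (hint : Integrable (fun ω => ψ (f ω)) P) :
    ∫ ω, φ ω * (g ⁻¹' t).indicator 1 ω * ψ (f ω) ∂P = ∫ ω, φ ω * p ω * ψ (f ω) ∂P := by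
  have hC : 0 ≤ C := by
    obtain ⟨ω⟩ := P.nonempty_of_neZero
    exact (norm_nonneg _).trans (hφC ω)
  have hgt := hg ht
  have hφ' := hφ.mono hm le_rfl
  have hp' := hp.mono hm le_rfl
  have hind : Measurable ((g ⁻¹' t).indicator (1 : Ω → ℝ)) := measurable_one.indicator hgt
  have hind1 : ∀ (s : Set Ω) ω, ‖s.indicator (1 : Ω → ℝ) ω‖ ≤ 1 := fun s ω => by
    by_cases hω : ω ∈ s <;> simp [hω]
  have hbA : ∀ ω, ‖φ ω * (g ⁻¹' t).indicator 1 ω‖ ≤ C := fun ω => by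
    rw [norm_mul]
    exact (mul_le_of_le_one_right (norm_nonneg _) (hind1 _ ω)).trans (hφC ω)
  have hbp : ∀ ω, ‖φ ω * p ω‖ ≤ C := fun ω => by
    rw [norm_mul]
    exact (mul_le_of_le_one_right (norm_nonneg _) (hp1 ω)).trans (hφC ω)
  have hiA : Integrable (fun ω => φ ω * (g ⁻¹' t).indicator 1 ω) P :=
    .of_bound (hφ'.mul hind).aestronglyMeasurable C (ae_of_all _ hbA)
  have hip : Integrable (fun ω => φ ω * p ω) P :=
    .of_bound (hφ'.mul hp').aestronglyMeasurable C (ae_of_all _ hbp)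
  -- `k` is orthogonal to all events generated by `f`, hence to all functions of `f`
  set k : Ω → ℝ := fun ω => φ ω * (g ⁻¹' t).indicator 1 ω - φ ω * p ω with hk
  have hki : Integrable k P := hiA.sub hip
  have hset : ∀ s : Set β, MeasurableSet s → ∫ ω in f ⁻¹' s, k ω ∂P = 0 := fun s hs => by
    have hfs := hf hs
    have hone : Integrable ((f ⁻¹' s).indicator (1 : Ω → ℝ)) P :=
      (integrable_const (1 : ℝ)).indicator hfs
    have hone' : Integrable ((f ⁻¹' s ∩ g ⁻¹' t).indicator (1 : Ω → ℝ)) P :=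
      (integrable_const (1 : ℝ)).indicator (hfs.inter hgt)
    have e1 := integral_mul_condExp (μ := P) hm (φ := φ) hφ.stronglyMeasurable
      (hone'.bdd_mul hφ'.aestronglyMeasurable (ae_of_all _ hφC)) hone'
    have e2 := integral_mul_condExp (μ := P) hm (φ := fun ω => φ ω * p ω)
      (hφ.mul hp).stronglyMeasurable
      (hone.bdd_mul (hφ'.mul hp').aestronglyMeasurable (ae_of_all _ hbp)) hone
    have e3 : ∫ ω in f ⁻¹' s, φ ω * (g ⁻¹' t).indicator 1 ω ∂P =
        ∫ ω, φ ω * (f ⁻¹' s ∩ g ⁻¹' t).indicator 1 ω ∂P := by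
      rw [← integral_indicator hfs]
      congr 1 with ω
      by_cases h1 : ω ∈ f ⁻¹' s <;> by_cases h2 : ω ∈ g ⁻¹' t <;>
        simp only [Set.indicator, Set.mem_inter_iff, h1, h2] <;> simp
    have e4 : ∫ ω in f ⁻¹' s, φ ω * p ω ∂P =
        ∫ ω, φ ω * p ω * (f ⁻¹' s).indicator 1 ω ∂P := by
      rw [← integral_indicator hfs]
      congr 1 with ω
      by_cases h1 : ω ∈ f ⁻¹' s <;> simp only [Set.indicator, h1] <;> simp
    rw [hk, integral_sub hiA.integrableOn hip.integrableOn, e3, e4, ← e1, ← e2, sub_eq_zero]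
    refine integral_congr_ae ?_
    filter_upwards [h s t hs ht, hpt] with ω h1 h2
    have h1' : (P[(f ⁻¹' s ∩ g ⁻¹' t).indicator 1 | m']) ω =
      (P[(f ⁻¹' s).indicator 1 | m']) ω * (P[(g ⁻¹' t).indicator 1 | m']) ω := h1
    have h2' : p ω = (P[(g ⁻¹' t).indicator 1 | m']) ω := h2
    rw [h1', h2']
    ring
  have hk0 : (0 : Ω → ℝ) =ᵐ[P] P[k | MeasurableSpace.comap f inferInstance] := by
    refine ae_eq_condExp_of_forall_setIntegral_eq hf.comap_le hki
      (fun s _ _ => (integrable_zero _ _ _).integrableOn) ?_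
      stronglyMeasurable_zero.aestronglyMeasurable
    rintro _ ⟨s, hs, rfl⟩ -
    rw [hset s hs]
    simp
  have hA : Integrable (fun ω => φ ω * (g ⁻¹' t).indicator 1 ω * ψ (f ω)) P :=
    hint.bdd_mul hiA.aestronglyMeasurable (ae_of_all _ hbA)
  have hp2 : Integrable (fun ω => φ ω * p ω * ψ (f ω)) P :=
    hint.bdd_mul hip.aestronglyMeasurable (ae_of_all _ hbp)
  have heq : (fun ω => ψ (f ω) * k ω) = fun ω =>
      φ ω * (g ⁻¹' t).indicator 1 ω * ψ (f ω) - φ ω * p ω * ψ (f ω) := by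
    ext ω
    simp only [hk]
    ring
  have e := integral_mul_condExp (μ := P) hf.comap_le (φ := fun ω => ψ (f ω)) (f := k)
    (hψ.comp (comap_measurable f)).stronglyMeasurable (by rw [heq]; exact hA.sub hp2) hki
  rw [heq, integral_sub hA hp2] at e
  refine sub_eq_zero.1 (e.symm.trans (integral_eq_zero_of_ae ?_))
  filter_upwards [hk0] with ω hω
  simp [← hω]

variable {𝒟 𝒵 𝒳 : Type*} [DecidableEq 𝒟] [DecidableEq 𝒵]
  [MeasurableSpace 𝒟] [MeasurableSingletonClass 𝒟]
  [Finite 𝒵] [MeasurableSpace 𝒵] [MeasurableSingletonClass 𝒵] [MeasurableSpace 𝒳]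
  {ν : Measure (Obs 𝒟 𝒵 𝒳)} [IsProbabilityMeasure ν] {η : Nuisance 𝒟 𝒵 𝒳} {κ : ℝ}
  {H : Ω → Obs 𝒟 𝒵 𝒳} {Ypot : 𝒟 → 𝒵 → Ω → ℝ}

/-- The potential outcomes have mean `E[Y^{d,z}] = E[Γ_{d,z}]`: weighting by the inverse of `ω_{d,z}`
undoes first the selection on `D`, then that on `Z`. -/
lemma Identifying.integral_gamma (hid : Identifying P H Ypot) (hH : Measurable H)
    (hlaw : P.map H = ν) (hY : Integrable outcome ν) (hη : IsTrueNuisance ν η) (hκ : 0 < κ)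
    (hov : Overlap κ η) (d : 𝒟) (z : 𝒵) :
    ∫ h, gamma η d z h ∂ν = ∫ ω, Ypot d z ω ∂P := by
  have hmp : MeasurePreserving H P ν := ⟨hH, hlaw⟩
  have hcov : Measurable (covar : Obs 𝒟 𝒵 𝒳 → 𝒳) := by fun_prop
  have hmod : Measurable (moder : Obs 𝒟 𝒵 𝒳 → 𝒵) := by fun_prop
  have htr : Measurable (treat : Obs 𝒟 𝒵 𝒳 → 𝒟) := by fun_prop
  have hw := hη.measurable_cellProb d z
  have hw0 : ∀ x, cellProb η d z x ≠ 0 := fun x =>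
    ((sq_nonneg κ).trans_lt (hov.sq_lt_cellProb hκ d z x)).ne'
  have hps1 : ∀ z x, ‖η.ps d z x‖ ≤ 1 := fun z x => by
    rw [Real.norm_eq_abs, abs_le]; constructor <;> linarith [hov.1 d z x]
  have hmps1 : ∀ x, ‖η.mps z x‖ ≤ 1 := fun x => by
    rw [Real.norm_eq_abs, abs_le]; constructor <;> linarith [hov.2 z x]
  -- the potential outcome `Y^{d,Z}`
  have hYdm : ∀ d, Measurable fun ω => Ypot d (moder (H ω)) ω := fun d =>
    (measurable_from_prod_countable_right (f := fun q : 𝒵 × Ω => Ypot d q.1 q.2)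
      (hid.measurable d)).comp ((hmod.comp hH).prodMk measurable_id)
  have hYdi : Integrable (fun ω => Ypot d (moder (H ω)) ω) P := by
    have := Fintype.ofFinite 𝒵
    refine (integrable_finsetSum Finset.univ fun z _ => (hid.integrable d z).norm).mono'
      (hYdm d).aestronglyMeasurable (ae_of_all _ fun ω => ?_)
    exact Finset.single_le_sum (f := fun z => ‖Ypot d z ω‖) (fun _ _ => norm_nonneg _)
      (Finset.mem_univ _)
  have hpsZ : Measurable fun q : 𝒵 × 𝒳 => η.ps d q.1 q.2 :=
    measurable_from_prod_countable_right fun z => hη.measurable_ps d z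
  have hφm : Measurable fun q : 𝒵 × 𝒳 =>
      (if q.1 = z then (1 : ℝ) else 0) * (cellProb η d z q.2)⁻¹ :=
    (Measurable.ite (measurable_fst (measurableSet_singleton z)) measurable_const
      measurable_const).mul (hw.inv.comp measurable_snd)
  have hleZX : (sigmaZX 𝒟 𝒵 𝒳).comap H ≤ mΩ :=
    (MeasurableSpace.comap_mono sigmaZX_le).trans hH.comap_le
  have hleX : (sigmaX 𝒟 𝒵 𝒳).comap H ≤ mΩ :=
    (MeasurableSpace.comap_mono sigmaX_le).trans hH.comap_le
  -- selection on the treatment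
  have e1 := hid.cia_treat.integral_indicator_eq hleZX
    (measurable_pi_lambda _ hYdm) (htr.comp hH) (measurableSet_singleton d)
    (p := fun ω => η.ps d (moder (H ω)) (covar (H ω)))
    (φ := fun ω => (if moder (H ω) = z then (1 : ℝ) else 0) * (cellProb η d z (covar (H ω)))⁻¹)
    ((measurable_sigmaZX hpsZ).comp (comap_measurable H)) (fun ω => hps1 _ _)
    (by
      have h1 := condExp_comp_ae_eq sigmaZX_le hmp (f := ({h | treat h = d}).indicator
        fun _ => (1 : ℝ)) ((integrable_const _).indicator (measurableSet_treat_eq d))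
      exact (hmp.quasiMeasurePreserving.ae_eq_comp (hη.ps_eq d)).trans h1)
    ((measurable_sigmaZX hφm).comp (comap_measurable H)) (C := (κ ^ 2)⁻¹)
    (fun ω => by
      rw [norm_mul]
      refine (mul_le_of_le_one_left (norm_nonneg _) ?_).trans
        (hov.norm_inv_cellProb_le hκ d z _)
      split_ifs <;> simp)
    (ψ := fun y => y d) (measurable_pi_apply d) hYdi
  -- selection on the moderator
  have e2 := hid.cia_moder.integral_indicator_eq hleX
    (measurable_pi_lambda _ fun q => hid.measurable q.1 q.2) (hmod.comp hH)
    (measurableSet_singleton z)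
    (p := fun ω => η.mps z (covar (H ω)))
    (φ := fun ω => (cellProb η d z (covar (H ω)))⁻¹ * η.ps d z (covar (H ω)))
    ((measurable_sigmaX (hη.measurable_mps z)).comp (comap_measurable H)) (fun ω => hmps1 _)
    (by
      have h1 := condExp_comp_ae_eq sigmaX_le hmp (f := ({h | moder h = z}).indicator
        fun _ => (1 : ℝ)) ((integrable_const _).indicator (measurableSet_moder_eq z))
      exact (hmp.quasiMeasurePreserving.ae_eq_comp (hη.mps_eq z)).trans h1)
    ((measurable_sigmaX (hw.inv.mul (hη.measurable_ps d z))).comp (comap_measurable H))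
    (C := (κ ^ 2)⁻¹)
    (fun ω => by
      rw [norm_mul]
      exact (mul_le_of_le_one_right (norm_nonneg _) (hps1 _ _)).trans
        (hov.norm_inv_cellProb_le hκ d z _))
    (ψ := fun y => y (d, z)) (measurable_pi_apply _) (hid.integrable d z)
  have hreg := hη.measurable_reg d z
  have hμ := hη.integral_cellInd_mul hκ hov d z (f := fun x => η.reg d z x *
    (cellProb η d z x)⁻¹) (hreg.mul hw.inv)
  have hμi : Integrable (fun h : Obs 𝒟 𝒵 𝒳 => cellInd d z h *
      (η.reg d z (covar h) * (cellProb η d z (covar h))⁻¹)) ν :=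
    ((hη.integrable_reg hκ hov d z).mul_bdd (c := (κ ^ 2)⁻¹)
      (hw.inv.comp hcov).aestronglyMeasurable
      (ae_of_all _ fun h => hov.norm_inv_cellProb_le hκ d z _)).bdd_mul (c := 1)
      (measurable_cellInd d z).aestronglyMeasurable (ae_of_all _ fun h => by
        rw [Real.norm_of_nonneg (cellInd_nonneg d z h)]
        exact cellInd_le_one d z h)
  have hcell : Measurable (cellInd d z : Obs 𝒟 𝒵 𝒳 → ℝ) := measurable_cellInd d z
  calc ∫ h, gamma η d z h ∂ν
      = ∫ h, cellInd d z h * (outcome h - η.reg d z (covar h)) *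
            (cellProb η d z (covar h))⁻¹ ∂ν +
          ∫ h, cellInd d z h * (η.reg d z (covar h) * (cellProb η d z (covar h))⁻¹) ∂ν := by
        simp_rw [gamma_eq]
        rw [integral_add (hη.integrable_reg hκ hov d z)
          (hη.integrable_weighted_residual hY hκ hov d z), hμ, add_comm]
        congr 2 with h
        field_simp [hw0 (covar h)]
    _ = ∫ h, cellInd d z h * (cellProb η d z (covar h))⁻¹ * outcome h ∂ν := by
        rw [← integral_add (hη.integrable_weighted_residual hY hκ hov d z) hμi]
        congr 1 with h
        ring
    _ = ∫ ω, cellInd d z (H ω) * (cellProb η d z (covar (H ω)))⁻¹ * outcome (H ω) ∂P := by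
        rw [← hlaw, integral_map hH.aemeasurable (by fun_prop)]
    _ = ∫ ω, (if moder (H ω) = z then (1 : ℝ) else 0) * (cellProb η d z (covar (H ω)))⁻¹ *
          ((fun ω => treat (H ω)) ⁻¹' {d}).indicator 1 ω * Ypot d (moder (H ω)) ω ∂P := by
        refine integral_congr_ae ?_
        filter_upwards [hid.sutva] with ω hω
        rw [hω]
        by_cases h1 : treat (H ω) = d <;> by_cases h2 : moder (H ω) = z <;>
          simp [cellInd, Set.indicator, h1, h2]
    _ = ∫ ω, (cellProb η d z (covar (H ω)))⁻¹ * η.ps d z (covar (H ω)) *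
          ((fun ω => moder (H ω)) ⁻¹' {z}).indicator 1 ω * Ypot d z ω ∂P := by
        refine e1.trans ?_
        congr 1 with ω
        by_cases h2 : moder (H ω) = z <;> simp [Set.indicator, h2]
    _ = ∫ ω, Ypot d z ω ∂P := by
        refine e2.trans ?_
        congr 1 with ω
        have := hw0 (covar (H ω))
        rw [mul_assoc _ (η.ps d z _)]
        change (cellProb η d z _)⁻¹ * cellProb η d z _ * _ = _
        rw [inv_mul_cancel₀ this, one_mul]

/-- Under the identifying assumptions the estimand is the causal effect. -/
lemma Identifying.estimand_eq (hid : Identifying P H Ypot) (hH : Measurable H)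
    (hlaw : P.map H = ν) (hY : Integrable outcome ν) (hη : IsTrueNuisance ν η) (hκ : 0 < κ)
    (hov : Overlap κ η) (l m : 𝒟) (u v : 𝒵) :
    estimand ν η l m u v = ∫ ω, ((Ypot l u ω - Ypot m u ω) - (Ypot l v ω - Ypot m v ω)) ∂P := by
  have hg := hη.integrable_gamma hY hκ hov
  have hE := hid.integral_gamma hH hlaw hY hη hκ hov
  have hi := hid.integrable
  have g1 : Integrable (fun h => gamma η l u h - gamma η m u h) ν := (hg l u).sub (hg m u)
  have g2 : Integrable (fun h => gamma η l u h - gamma η m u h - gamma η l v h) ν :=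
    g1.sub (hg l v)
  have i1 : Integrable (fun ω => Ypot l u ω - Ypot m u ω) P := (hi l u).sub (hi m u)
  have i2 : Integrable (fun ω => Ypot l v ω - Ypot m v ω) P := (hi l v).sub (hi m v)
  unfold estimand contrast
  rw [integral_add g2 (hg m v), integral_sub g1 (hg l v), integral_sub (hg l u) (hg m u),
    hE, hE, hE, hE, integral_sub i1 i2, integral_sub (hi l u) (hi m u),
    integral_sub (hi l v) (hi m v)]
  ring

end Identification

end CBGATE

theorem theorem3
    {Ω 𝒟 𝒵 𝒳 𝒰 : Type*} [MeasurableSpace Ω]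
    [Finite 𝒟] [DecidableEq 𝒟] [MeasurableSpace 𝒟] [MeasurableSingletonClass 𝒟]
    [Finite 𝒵] [DecidableEq 𝒵] [MeasurableSpace 𝒵] [MeasurableSingletonClass 𝒵]
    [MeasurableSpace 𝒳] [MeasurableSpace 𝒰]
    (P : Measure Ω) [IsProbabilityMeasure P]
    -- the law of an observation, an i.i.d. sample from it
    (ν : Measure (CBGATE.Obs 𝒟 𝒵 𝒳)) [IsProbabilityMeasure ν]
    (H : ℕ → Ω → CBGATE.Obs 𝒟 𝒵 𝒳) (hH : ∀ i, Measurable (H i))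
    (hlaw : ∀ i, P.map (H i) = ν) (hindep : iIndepFun H P)
    -- the true nuisance functions
    (hY : Integrable CBGATE.outcome ν)
    (η : CBGATE.Nuisance 𝒟 𝒵 𝒳) (hη : CBGATE.IsTrueNuisance ν η)
    -- the random folds and the seed of the learner are independent of the data
    (K : ℕ) (hK : 1 < K) (S : (N : ℕ) → Ω → Fin N → Fin K) (hS : ∀ N, Measurable (S N))
    (hbal : ∀ᵐ ω ∂P, ∀ N, CBGATE.Balanced (S N ω))
    (U : ℕ → Ω → 𝒰) (hU : ∀ N, Measurable (U N))
    (hSU : ∀ N, IndepFun (fun ω => (S N ω, U N ω)) (fun ω i => H i ω) P)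
    (L : CBGATE.Learner 𝒟 𝒵 𝒳 𝒰)
    -- overlap, for the true and for the estimated propensities
    (κ : ℝ) (hκ : 0 < κ) (hoverlap : CBGATE.Overlap κ η)
    (hoverlap_est : ∀ᵐ ω ∂P, ∀ N k, CBGATE.Overlap κ (CBGATE.crossFit L H U S N k ω))
    -- consistency and risk decay of the nuisance estimators of each fold
    (hcons : ∀ k, CBGATE.Consistent P (fun N ω => CBGATE.crossFit L H U S N k ω) η)
    (hrisk : ∀ k, CBGATE.RiskDecay P ν (fun N ω => CBGATE.crossFit L H U S N k ω) η)
    -- bounded conditional variance of the outcome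
    (hvar : CBGATE.BoundedCondVar ν)
    -- the two treatments and the two moderator groups; the asymptotic variance is finite
    (l m : 𝒟) (u v : 𝒵)
    (hφ : MemLp (CBGATE.score l m u v (CBGATE.estimand ν η l m u v) η) 2 ν) :
    TendstoInDistribution
        (fun (N : ℕ) ω => √(N : ℝ) *
          (CBGATE.estimator L H U S l m u v N ω - CBGATE.estimand ν η l m u v))
        atTop id (fun _ => P)
        (gaussianReal 0
          (∫ h, CBGATE.score l m u v (CBGATE.estimand ν η l m u v) η h ^ 2 ∂ν).toNNReal) ∧
      -- under the identifying assumptions the estimand is the causal effect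
      ∀ (i : ℕ) (Ypot : 𝒟 → 𝒵 → Ω → ℝ), CBGATE.Identifying P (H i) Ypot →
        CBGATE.estimand ν η l m u v =
          ∫ ω, ((Ypot l u ω - Ypot m u ω) - (Ypot l v ω - Ypot m v ω)) ∂P := by
  exact ⟨CBGATE.tendstoInDistribution_estimator hH hlaw hindep hY hη hS hU hSU hκ hoverlap
      hoverlap_est hcons hrisk hvar l m u v hφ,
    fun i _ hid => hid.estimand_eq (hH i) (hlaw i) hY hη hκ hoverlap l m u v⟩
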